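/- Let $n\ge 1$, $\mathbb{T}^n=\mathbb{R}^n/\mathbb{Z}^n$, $T>0$, $\varepsilon>0$ and $Q_T=\mathbb{T}^n\times(0,T)$. Let $H=H(x,t,p)$ be a real-valued function such that $p\mapsto H(x,t,p)$ is of class $C^1$ for a.e. $(x,t)\in Q_T$. For $i=1,2$ let $g_i\in L^\infty(\mathbb{T}^n)$, $f_i\in L^1(0,T;L^\infty(\mathbb{T}^n))$, and let $u_i$ be an energy solution of $$-\partial_t u_i-\varepsilon\Delta u_i+H(x,t,Du_i)=f_i\ \text{ in } Q_T,\qquad u_i(\cdot,T)=g_i\ \text{ in }\mathbb{T}^n,$$ that is, $u_i\in C([0,T];L^2(\mathbb{T}^n))\cap L^2(0,T;H^1(\mathbb{T}^n))$, $H(x,t,Du_i)$ is integrable on $\mathbb{T}^n\times(a,b)$ whenever $0<a<b<T$, the equation holds in the sense of distributions in $Q_T$, and $u_i(\cdot,T)=g_i$ a.e. Assume that the drift $$b(x,t)=\int_0^1 D_pH\bigl(x,t,\theta Du_1(x,t)+(1-\theta)Du_2(x,t)\bigr)\,d\theta$$ is essentially bounded on $Q_T$. Put $w=u_1-u_2$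 and $$K=\|g_1-g_2\|_{L^\infty(\mathbb{T}^n)}+\int_0^T\|f_1(t)-f_2(t)\|_{L^\infty(\mathbb{T}^n)}\,dt .$$ (a) For every $t\in(0,T)$ such that the distributional Laplacian $\Delta w(t)$ belongs to $L^1(\mathbb{T}^n)$, the function $w(t)$ has a weak gradient $Dw(t)\in L^2(\mathbb{T}^n)$ and $$\|D(u_1-u_2)(t)\|_{L^2(\mathbb{T}^n)}^2\le \|\Delta(u_1-u_2)(t)\|_{L^1(\mathbb{T}^n)}\,K .$$ (b) If the distributional (spatial) Laplacian $\Delta w$ belongs to $L^1(Q_T)$, then for a.e. $t\in(0,T)$ $$\|(Du_1-Du_2)(t)\|_{L^2(\mathbb{T}^n)}^2\le \|\Delta(u_1-u_2)(t)\|_{L^1(\mathbb{T}^n)}\,K ,$$ and moreover $$\|Du_1-Du_2\|_{L^2(Q_T)}^2\le \|\Delta(u_1-u_2)\|_{L^1(Q_T)}\,K .$$ -/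

import Mathlib

open MeasureTheory Set Filter Topology
open scoped ENNReal ContDiff

noncomputable section

namespace TorusHJ

/-- The flat torus `ℝⁿ / ℤⁿ`; `volume` on it is the normalized Haar (Lebesgue) measure. -/
abbrev Torus (n : ℕ) : Type := UnitAddTorus (Fin n)

/-- Euclidean space, in which gradients and momenta live. -/
abbrev Vec (n : ℕ) : Type := EuclideanSpace ℝ (Fin n)

/-- The canonical projection `ℝⁿ → ℝⁿ / ℤⁿ`. -/
def proj {n : ℕ} (y : Vec n) : Torus n := fun i => (y i : UnitAddCircle)

/-- The classical partial derivative `∂φ/∂xᵢ` of a function on the torus. -/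
def pderiv {n : ℕ} (i : Fin n) (φ : Torus n → ℝ) (x : Torus n) : ℝ :=
  deriv (fun s : ℝ => φ (x + Pi.single i (s : UnitAddCircle))) 0

/-- The classical Laplacian of a function on the torus. -/
def laplacian {n : ℕ} (φ : Torus n → ℝ) (x : Torus n) : ℝ :=
  ∑ i, pderiv i (pderiv i φ) x

/-- Smooth functions on the torus (smoothness of the periodic lift to `ℝⁿ`). -/
def IsSmooth {n : ℕ} (φ : Torus n → ℝ) : Prop :=
  ContDiff ℝ ∞ (fun y : Vec n => φ (proj y))

/-- Test functions on `𝕋ⁿ × (0,T)`: smooth, and vanishing outside a compact subset of times. -/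
def IsTestFunction {n : ℕ} (T : ℝ) (φ : ℝ → Torus n → ℝ) : Prop :=
  ContDiff ℝ ∞ (fun z : ℝ × Vec n => φ z.1 (proj z.2)) ∧
    ∃ a b : ℝ, 0 < a ∧ b < T ∧ ∀ t, t ∉ Icc a b → ∀ x, φ t x = 0

/-- The Lebesgue measure of the space-time cylinder `Q_T = (0,T) × 𝕋ⁿ`. -/
def cyl (n : ℕ) (T : ℝ) : Measure (ℝ × Torus n) :=
  (volume.restrict (Ioo 0 T)).prod volume

/-- `G` is the weak gradient of `v` on the torus, both being integrable. -/
def IsWeakGradient {n : ℕ} (v : Torus n → ℝ) (G : Torus n → Vec n) : Prop :=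
  Integrable v ∧ Integrable G ∧
    ∀ φ : Torus n → ℝ, IsSmooth φ → ∀ i,
      ∫ x, v x * pderiv i φ x = -∫ x, G x i * φ x

/-- `Δv = L` in the sense of distributions on the torus, with `L ∈ L¹(𝕋ⁿ)`. -/
def IsWeakLaplacian {n : ℕ} (v L : Torus n → ℝ) : Prop :=
  Integrable v ∧ Integrable L ∧
    ∀ φ : Torus n → ℝ, IsSmooth φ → ∫ x, v x * laplacian φ x = ∫ x, L x * φ x

/-- `Δw = L` (Laplacian in the space variable) in the sense of distributions on `Q_T`,
with `L ∈ L¹(Q_T)`. -/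
def IsWeakLaplacianCyl {n : ℕ} (T : ℝ) (w L : ℝ → Torus n → ℝ) : Prop :=
  Integrable (fun z : ℝ × Torus n => w z.1 z.2) (cyl n T) ∧
    Integrable (fun z : ℝ × Torus n => L z.1 z.2) (cyl n T) ∧
    ∀ φ : ℝ → Torus n → ℝ, IsTestFunction T φ →
      ∫ z, w z.1 z.2 * laplacian (φ z.1) z.2 ∂(cyl n T) = ∫ z, L z.1 z.2 * φ z.1 z.2 ∂(cyl n T)

/-- The space `L¹(0,T; L^∞(𝕋ⁿ))`. -/
def MemL1Linf {n : ℕ} (T : ℝ) (f : ℝ → Torus n → ℝ) : Prop :=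
  AEStronglyMeasurable (fun z : ℝ × Torus n => f z.1 z.2) (cyl n T) ∧
    ∫⁻ t in Ioo 0 T, eLpNorm (f t) ∞ volume < (∞ : ℝ≥0∞)

/-- `u`, with spatial weak gradient `Du`, is an energy solution of
`-∂ₜu - εΔu + H(x,t,Du) = f` in `𝕋ⁿ × (0,T)`, `u(·,T) = g`:
`u ∈ C([0,T]; L²(𝕋ⁿ)) ∩ L²(0,T; H¹(𝕋ⁿ))`, the term `H(x,t,Du)` is locally integrable in
`𝕋ⁿ × (0,T)`, the equation holds in the sense of distributions, and the terminal condition holds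
almost everywhere. -/
structure IsEnergySolution {n : ℕ} (ε T : ℝ) (H : Torus n → ℝ → Vec n → ℝ)
    (f : ℝ → Torus n → ℝ) (g : Torus n → ℝ)
    (u : ℝ → Torus n → ℝ) (Du : ℝ → Torus n → Vec n) : Prop where
  memLp_slice : ∀ t ∈ Icc 0 T, MemLp (u t) 2 volume
  continuous_L2 : ∀ t₀ ∈ Icc 0 T,
    Tendsto (fun t => eLpNorm (u t - u t₀) 2 volume) (𝓝[Icc 0 T] t₀) (𝓝 0)
  memLp : MemLp (fun z : ℝ × Torus n => u z.1 z.2) 2 (cyl n T)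
  memLp_grad : MemLp (fun z : ℝ × Torus n => Du z.1 z.2) 2 (cyl n T)
  isWeakGradient : ∀ᵐ t ∂(volume.restrict (Ioo 0 T)), IsWeakGradient (u t) (Du t)
  integrable_H : ∀ a b : ℝ, 0 < a → b < T →
    Integrable (fun z : ℝ × Torus n => H z.2 z.1 (Du z.1 z.2))
      ((volume.restrict (Ioo a b)).prod volume)
  equation : ∀ φ : ℝ → Torus n → ℝ, IsTestFunction T φ →
    ∫ z, (u z.1 z.2 * deriv (fun s => φ s z.2) z.1
        + ε * ∑ i, Du z.1 z.2 i * pderiv i (φ z.1) z.2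
        + H z.2 z.1 (Du z.1 z.2) * φ z.1 z.2) ∂(cyl n T)
      = ∫ z, f z.1 z.2 * φ z.1 z.2 ∂(cyl n T)
  terminal : u T =ᵐ[volume] g

/-- The drift `b(x,t) = ∫₀¹ D_pH(x,t, θ Du₁ + (1-θ) Du₂) dθ` of the linearized equation. -/
def drift {n : ℕ} (H : Torus n → ℝ → Vec n → ℝ) (Du₁ Du₂ : ℝ → Torus n → Vec n)
    (t : ℝ) (x : Torus n) : Vec n :=
  ∫ θ in (0 : ℝ)..1, gradient (H x t) (θ • Du₁ t x + (1 - θ) • Du₂ t x)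

/-- The quantity `‖g₁ - g₂‖_{L^∞} + ∫₀ᵀ ‖f₁(t) - f₂(t)‖_{L^∞} dt`. -/
def dataDist {n : ℕ} (T : ℝ) (f₁ f₂ : ℝ → Torus n → ℝ) (g₁ g₂ : Torus n → ℝ) : ℝ≥0∞ :=
  eLpNorm (g₁ - g₂) ∞ volume + ∫⁻ t in Ioo 0 T, eLpNorm (f₁ t - f₂ t) ∞ volume

end TorusHJ

end

noncomputable section

namespace TorusHJ

variable {n : ℕ}

/-! ### Calculus on the torus -/

/-! The difference `w` solves the linear equation `-∂ₜw - εΔw + h = f₁ - f₂` with `h = H(Du₁) -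
H(Du₂)`. The fundamental theorem of calculus along the segment from `Du₂` to `Du₁` gives `h = b ·
Dw`, hence `|h| ≤ M|Dw|`, and a linear equation with bounded drift obeys a maximum principle:
`|w(t)| ≤ K` almost everywhere (`IsEnergySolution.ae_abs_sub_le_dataDist`). Both parts then follow
from `∫|Dw|² = -∫ w Δw ≤ ‖w‖_∞ ‖Δw‖₁` at a fixed time.

The maximum principle is an energy estimate. Let `k(t) = G + ∫ₜᵀ F`, where `G` bounds the terminal
value and `F(t)` bounds the source. A C² penalty `P`, vanishing exactly on `(-∞, 0]`, is applied to
`ρ ∗ w - k`. Mollifying in space makes every term classical in `x`, and for fixed `x` absolutely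
continuous in `t` (`IsLinearSolution.conv_eq_add_integral`), so the chain rule is legitimate. The
inequality `P'² ≤ 2PP''` lets the diffusion absorb the drift, and `P'² ≤ 4P` handles the
mollification error, which tends to zero in `L²`. Grönwall bounds `∫ P(ρ ∗ w - k)` by a constant
times this error; removing the mollifier gives `w ≤ k` (`IsLinearSolution.ae_le`), and the same
applies to `-w`.

The interpolation step must also produce the gradient at a fixed time, where none is given. The
identity, applied to differences of mollifications, shows that their gradients are Cauchy in `L²`,
because the mollified Laplacians converge in `L¹` and the mollified functions stay bounded
(`exists_isWeakGradient_of_bounded`). This uses only `Δρₘ ∗ w = ρₘ ∗ L`, which is also available on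
almost every time slice when the Laplacian is known on the cylinder; uniqueness of weak gradients
identifies the limit with `Du₁ - Du₂`, and integration in time finishes part (b). -/

instance : IsProbabilityMeasure (volume : Measure UnitAddCircle) :=
  ⟨by simp [AddCircle.measure_univ]⟩

instance : Measure.IsNegInvariant (volume : Measure (Torus n)) :=
  Measure.IsAddHaarMeasure.isNegInvariant_of_regular _

theorem proj_surjective : Function.Surjective (proj : Vec n → Torus n) := by
  intro x
  choose r hr using fun i => QuotientAddGroup.mk_surjective (x i)
  exact ⟨WithLp.toLp 2 r, funext hr⟩

theorem proj_add (y z : Vec n) : proj (y + z) = proj y + proj z := by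
  ext i; simp [proj]

theorem proj_sub (y z : Vec n) : proj (y - z) = proj y - proj z := by
  ext i; simp [proj]

theorem proj_smul_single (i : Fin n) (s : ℝ) :
    proj (s • EuclideanSpace.single i (1 : ℝ)) = Pi.single i (s : UnitAddCircle) := by
  ext j
  by_cases h : j = i
  · subst h; simp [proj]
  · simp [proj, h]

/-- Regularity is defined through periodic lifts; the quotient property brings continuity back down
to the torus. -/
theorem isOpenQuotientMap_proj : IsOpenQuotientMap (proj : Vec n → Torus n) := by
  have h1 : IsOpenMap (Pi.map fun (_ : Fin n) (r : ℝ) => (r : UnitAddCircle)) :=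
    IsOpenMap.piMap (fun _ => QuotientAddGroup.isOpenMap_coe)
      (Eventually.of_forall fun _ => QuotientAddGroup.mk_surjective)
  refine ⟨proj_surjective, ?_, ?_⟩
  · refine continuous_pi fun i => ?_
    exact (AddCircle.continuous_mk' 1).comp (EuclideanSpace.proj (𝕜 := ℝ) i).continuous
  · exact h1.comp (EuclideanSpace.equiv (Fin n) ℝ).toHomeomorph.isOpenMap

/-- `φ'` is the partial derivative of `φ` in the direction `i`, everywhere on the torus. -/
def HasPartial (i : Fin n) (φ φ' : Torus n → ℝ) : Prop :=
  ∀ x, HasDerivAt (fun s : ℝ => φ (x + Pi.single i (s : UnitAddCircle))) (φ' x) 0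

theorem HasPartial.pderiv_eq {i : Fin n} {φ φ' : Torus n → ℝ} (h : HasPartial i φ φ') :
    pderiv i φ = φ' :=
  funext fun x => (h x).deriv

theorem HasPartial.hasDerivAt {i : Fin n} {φ φ' : Torus n → ℝ} (h : HasPartial i φ φ')
    (x : Torus n) (s : ℝ) :
    HasDerivAt (fun s : ℝ => φ (x + Pi.single i (s : UnitAddCircle)))
      (φ' (x + Pi.single i (s : UnitAddCircle))) s := by
  have h1 := h (x + Pi.single i (s : UnitAddCircle))
  rw [← sub_self s] at h1
  have h2 := h1.comp_sub_const s s
  refine h2.congr_of_eventuallyEq (Eventually.of_forall fun r => ?_)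
  simp only [AddCircle.coe_sub, add_assoc, ← Pi.single_add]
  congr 3
  abel

theorem HasPartial.mul {i : Fin n} {φ φ' ψ ψ' : Torus n → ℝ} (h : HasPartial i φ φ')
    (k : HasPartial i ψ ψ') :
    HasPartial i (fun x => φ x * ψ x) (fun x => φ' x * ψ x + φ x * ψ' x) := by
  intro x
  simpa using (h x).fun_mul (k x)

theorem HasPartial.sub {i : Fin n} {φ φ' ψ ψ' : Torus n → ℝ} (h : HasPartial i φ φ')
    (k : HasPartial i ψ ψ') :
    HasPartial i (fun x => φ x - ψ x) (fun x => φ' x - ψ' x) :=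
  fun x => (h x).sub (k x)

theorem HasPartial.comp {i : Fin n} {φ φ' : Torus n → ℝ} {Φ Φ' : ℝ → ℝ} (h : HasPartial i φ φ')
    (k : ∀ r, HasDerivAt Φ (Φ' r) r) :
    HasPartial i (fun x => Φ (φ x)) (fun x => Φ' (φ x) * φ' x) := by
  intro x
  have h1 := (k (φ x))
  have h2 := h x
  have h3 : φ x = φ (x + Pi.single i ((0 : ℝ) : UnitAddCircle)) := by simp
  rw [h3] at h1
  have h4 := h1.comp (0 : ℝ) h2
  rwa [← h3] at h4

theorem exists_bound_of_continuous {φ : Torus n → ℝ} (h : Continuous φ) :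
    ∃ C, 0 ≤ C ∧ ∀ x, ‖φ x‖ ≤ C := by
  obtain ⟨C, hC⟩ := isCompact_univ.exists_bound_of_continuousOn h.continuousOn
  exact ⟨C, (norm_nonneg _).trans (hC 0 (mem_univ _)), fun x => hC x (mem_univ _)⟩

theorem integrable_of_continuous {φ : Torus n → ℝ} (h : Continuous φ) : Integrable φ := by
  obtain ⟨C, -, hC⟩ := exists_bound_of_continuous h
  exact Integrable.of_bound h.aestronglyMeasurable C (Eventually.of_forall hC)

/-- By translation invariance `s ↦ ∫ φ(x + s eᵢ)` is constant; differentiating under the integral at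
`s = 0` gives the claim. All integrations by parts rest on this. -/
theorem HasPartial.integral_eq_zero {i : Fin n} {φ φ' : Torus n → ℝ} (h : HasPartial i φ φ')
    (hφ : Continuous φ) (hφ' : Continuous φ') : ∫ x, φ' x = 0 := by
  obtain ⟨C, -, hC⟩ := exists_bound_of_continuous hφ'
  have hc : ∀ {ψ : Torus n → ℝ}, Continuous ψ → ∀ s : ℝ,
      Continuous fun x : Torus n => ψ (x + Pi.single i (s : UnitAddCircle)) :=
    fun hψ s => hψ.comp (continuous_add_const _)
  have key := (hasDerivAt_integral_of_dominated_loc_of_deriv_le (μ := (volume : Measure (Torus n)))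
    (F := fun (s : ℝ) (x : Torus n) => φ (x + Pi.single i (s : UnitAddCircle)))
    (F' := fun (s : ℝ) (x : Torus n) => φ' (x + Pi.single i (s : UnitAddCircle))) (x₀ := 0)
    (s := univ) (bound := fun _ => C) univ_mem
    (Eventually.of_forall fun s => (hc hφ s).aestronglyMeasurable)
    (integrable_of_continuous (hc hφ 0)) (hc hφ' 0).aestronglyMeasurable
    (Eventually.of_forall fun x s _ => hC _) (integrable_const C)
    (Eventually.of_forall fun x s _ => h.hasDerivAt x s)).2
  have e1 : (fun s : ℝ => ∫ x : Torus n, φ (x + Pi.single i (s : UnitAddCircle))) =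
      fun _ => ∫ x, φ x := by
    ext s
    exact integral_add_right_eq_self φ _
  rw [e1] at key
  have e2 := key.unique (hasDerivAt_const (0 : ℝ) _)
  simpa using e2

theorem HasPartial.integral_mul {i : Fin n} {φ φ' ψ ψ' : Torus n → ℝ} (h : HasPartial i φ φ')
    (k : HasPartial i ψ ψ') (hφ : Continuous φ) (hφ' : Continuous φ') (hψ : Continuous ψ)
    (hψ' : Continuous ψ') : ∫ x, φ x * ψ' x = -∫ x, φ' x * ψ x := by
  have h1 := (h.mul k).integral_eq_zero (hφ.mul hψ) ((hφ'.mul hψ).add (hφ.mul hψ'))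
  rw [integral_add (integrable_of_continuous (by fun_prop))
    (integrable_of_continuous (by fun_prop))] at h1
  linarith

theorem IsSmooth.continuous {φ : Torus n → ℝ} (h : IsSmooth φ) : Continuous φ :=
  isOpenQuotientMap_proj.isQuotientMap.continuous_iff.2 (ContDiff.continuous h)

theorem IsSmooth.hasPartial_fderiv {φ : Torus n → ℝ} (h : IsSmooth φ) (i : Fin n) (y : Vec n) :
    HasDerivAt (fun s : ℝ => φ (proj y + Pi.single i (s : UnitAddCircle)))
      (fderiv ℝ (fun y : Vec n => φ (proj y)) y (EuclideanSpace.single i 1)) 0 := by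
  have h1 : HasFDerivAt (fun y : Vec n => φ (proj y)) (fderiv ℝ (fun y : Vec n => φ (proj y)) y)
      (y + (0 : ℝ) • EuclideanSpace.single i (1 : ℝ)) := by
    rw [zero_smul, add_zero]
    exact (h.differentiable (by simp) y).hasFDerivAt
  have h2 : HasDerivAt (fun s : ℝ => y + s • EuclideanSpace.single i (1 : ℝ))
      (EuclideanSpace.single i (1 : ℝ)) 0 := by
    simpa using ((hasDerivAt_id (0 : ℝ)).smul_const (EuclideanSpace.single i (1 : ℝ))).const_add y
  have h3 := h1.comp_hasDerivAt (0 : ℝ) h2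
  refine h3.congr_of_eventuallyEq (Eventually.of_forall fun s => ?_)
  simp only [Function.comp, proj_add, proj_smul_single]

theorem IsSmooth.pderiv_proj {φ : Torus n → ℝ} (h : IsSmooth φ) (i : Fin n) (y : Vec n) :
    pderiv i φ (proj y) =
      fderiv ℝ (fun y : Vec n => φ (proj y)) y (EuclideanSpace.single i 1) :=
  (h.hasPartial_fderiv i y).deriv

theorem IsSmooth.hasPartial {φ : Torus n → ℝ} (h : IsSmooth φ) (i : Fin n) :
    HasPartial i φ (pderiv i φ) := by
  intro x
  obtain ⟨y, rfl⟩ := proj_surjective x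
  rw [h.pderiv_proj]
  exact h.hasPartial_fderiv i y

theorem IsSmooth.pderiv {φ : Torus n → ℝ} (h : IsSmooth φ) (i : Fin n) :
    IsSmooth (pderiv i φ) := by
  unfold IsSmooth
  simp only [h.pderiv_proj]
  exact (ContDiff.fderiv_right h (m := ∞) (by simp)).clm_apply contDiff_const

theorem IsSmooth.sum {ι : Type*} {s : Finset ι} {φ : ι → Torus n → ℝ}
    (h : ∀ i ∈ s, IsSmooth (φ i)) : IsSmooth (fun x => ∑ i ∈ s, φ i x) :=
  ContDiff.sum h

theorem IsSmooth.laplacian {φ : Torus n → ℝ} (h : IsSmooth φ) : IsSmooth (laplacian φ) :=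
  IsSmooth.sum fun i _ => (h.pderiv i).pderiv i

/-- Makes the kernel `y ↦ ρ(x - y)` an admissible test function, so that weak identities become
pointwise identities between convolutions. -/
theorem IsSmooth.const_sub {φ : Torus n → ℝ} (h : IsSmooth φ) (x : Torus n) :
    IsSmooth (fun y => φ (x - y)) := by
  obtain ⟨z, rfl⟩ := proj_surjective x
  unfold IsSmooth
  simp only [← proj_sub]
  exact ContDiff.comp (g := fun y : Vec n => φ (proj y)) h (contDiff_const.sub contDiff_id)

theorem IsSmooth.hasPartial_const_sub {φ : Torus n → ℝ} (h : IsSmooth φ) (i : Fin n)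
    (x : Torus n) : HasPartial i (fun y => φ (x - y)) (fun y => -TorusHJ.pderiv i φ (x - y)) := by
  intro y
  have h1 := (h.hasPartial i).hasDerivAt (x - y) (-0)
  have h2 := h1.scomp (0 : ℝ) (hasDerivAt_neg (0 : ℝ))
  simp only [neg_zero, AddCircle.coe_zero, Pi.single_zero, add_zero, neg_smul, one_smul] at h2
  refine h2.congr_of_eventuallyEq (Eventually.of_forall fun s => ?_)
  simp only [Function.comp, AddCircle.coe_neg, Pi.single_neg]
  congr 1
  abel

theorem IsSmooth.pderiv_const_sub {φ : Torus n → ℝ} (h : IsSmooth φ) (i : Fin n) (x : Torus n) :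
    TorusHJ.pderiv i (fun y => φ (x - y)) = fun y => -TorusHJ.pderiv i φ (x - y) :=
  (h.hasPartial_const_sub i x).pderiv_eq

theorem IsSmooth.pderiv_pderiv_const_sub {φ : Torus n → ℝ} (h : IsSmooth φ) (i : Fin n)
    (x : Torus n) : TorusHJ.pderiv i (TorusHJ.pderiv i (fun y => φ (x - y))) =
      fun y => TorusHJ.pderiv i (TorusHJ.pderiv i φ) (x - y) := by
  rw [h.pderiv_const_sub]
  refine HasPartial.pderiv_eq fun y => ?_
  simpa using (((h.pderiv i).hasPartial_const_sub i x) y).fun_neg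

theorem IsSmooth.laplacian_const_sub {φ : Torus n → ℝ} (h : IsSmooth φ) (x : Torus n) :
    TorusHJ.laplacian (fun y => φ (x - y)) = fun y => TorusHJ.laplacian φ (x - y) := by
  ext y
  unfold TorusHJ.laplacian
  simp only [h.pderiv_pderiv_const_sub]

theorem IsSmooth.isTestFunction {φ : Torus n → ℝ} (h : IsSmooth φ) {T a b : ℝ} {η : ℝ → ℝ}
    (hη : ContDiff ℝ ∞ η) (ha : 0 < a) (hb : b < T) (hs : ∀ t, t ∉ Icc a b → η t = 0) :
    IsTestFunction T (fun t y => η t * φ y) :=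
  ⟨(hη.comp contDiff_fst).mul (ContDiff.comp (g := fun y : Vec n => φ (proj y)) h contDiff_snd),
    a, b, ha, hb, fun t ht x => by simp [hs t ht]⟩

/-! ### A smooth positive approximate identity -/

/-- A smooth positive function on the torus whose only maximum is at the origin. -/
def peak (x : Torus n) : ℝ := Real.exp (∑ i, (fourier 1 (x i)).re)

theorem isSmooth_peak : IsSmooth (peak : Torus n → ℝ) := by
  unfold IsSmooth peak proj
  refine Real.contDiff_exp.comp (ContDiff.sum fun i _ => ?_)
  have : (fun y : Vec n => (fourier 1 ((y i : ℝ) : UnitAddCircle) : ℂ).re) =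
      fun y => Real.cos (2 * Real.pi * y i) := by
    ext y
    rw [fourier_coe_apply, ← Complex.exp_ofReal_mul_I_re]
    congr 2
    push_cast
    ring
  rw [this]
  exact Real.contDiff_cos.comp (contDiff_const.mul (EuclideanSpace.proj (𝕜 := ℝ) i).contDiff)

theorem peak_lt {x : Torus n} (hx : x ≠ 0) : peak x < peak (0 : Torus n) := by
  have hle : ∀ a : UnitAddCircle, (fourier 1 a).re ≤ 1 := fun a =>
    (Complex.re_le_norm _).trans (by rw [fourier_apply, Circle.norm_coe])
  refine Real.exp_lt_exp.2 (Finset.sum_lt_sum (fun i _ => by simpa using hle (x i)) ?_)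
  obtain ⟨i, hi⟩ := Function.ne_iff.1 hx
  refine ⟨i, Finset.mem_univ _, ?_⟩
  simp only [Pi.zero_apply, fourier_eval_zero, Complex.one_re]
  refine lt_of_le_of_ne (hle _) fun h => hi ?_
  have h1 : (fourier 1 (x i) : ℂ) = 1 := by
    have h2 : ‖(fourier 1 (x i) : ℂ)‖ = 1 := by rw [fourier_apply, Circle.norm_coe]
    have h3 := Complex.sq_norm (fourier 1 (x i))
    rw [Complex.normSq_apply, h2, h] at h3
    exact Complex.ext h (by simpa using h3)
  rw [fourier_one] at h1
  apply AddCircle.injective_toCircle (T := 1) one_ne_zero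
  rw [Pi.zero_apply, AddCircle.toCircle_zero]
  exact Circle.ext h1

/-- The normalized powers of `peak`. -/
def mollifier (m : ℕ) (x : Torus n) : ℝ := (∫ y, peak (y : Torus n) ^ m)⁻¹ * peak x ^ m

theorem isSmooth_mollifier (m : ℕ) : IsSmooth (mollifier m : Torus n → ℝ) :=
  contDiff_const.mul (ContDiff.pow isSmooth_peak m)

theorem integral_peak_pow_pos (m : ℕ) : 0 < ∫ y, peak (y : Torus n) ^ m := by
  have hc : Continuous fun y : Torus n => peak y ^ m := isSmooth_peak.continuous.pow m
  exact hc.integral_pos_of_hasCompactSupport_nonneg_nonzero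
    (HasCompactSupport.of_compactSpace _) (fun y => (pow_pos (Real.exp_pos _) m).le)
    (x := 0) (pow_pos (Real.exp_pos _) m).ne'

theorem mollifier_nonneg (m : ℕ) (x : Torus n) : 0 ≤ mollifier m x :=
  mul_nonneg (inv_nonneg.2 (integral_peak_pow_pos m).le) (pow_pos (Real.exp_pos _) m).le

theorem integral_mollifier (m : ℕ) : ∫ x, mollifier m (x : Torus n) = 1 := by
  unfold mollifier
  rw [integral_const_mul, inv_mul_cancel₀ (integral_peak_pow_pos m).ne']

/-- Laplace's method: high powers of a positive function with a unique maximum, once normalized,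
concentrate at that maximum. The kernels need not have shrinking supports. -/
theorem tendsto_integral_mollifier_mul {g : Torus n → ℝ} (hg : Continuous g) :
    Tendsto (fun m : ℕ => ∫ x, mollifier m x * g x) atTop (𝓝 (g 0)) := by
  have h := tendsto_setIntegral_pow_smul_of_unique_maximum_of_isCompact_of_continuousOn
    (μ := (volume : Measure (Torus n))) (s := univ) (x₀ := 0) (c := peak) (g := g) isCompact_univ
    isSmooth_peak.continuous.continuousOn (fun y _ hy => peak_lt hy)
    (fun x _ => (Real.exp_pos _).le) (Real.exp_pos _) (by simp) hg.continuousOn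
  simpa [mollifier, setIntegral_univ, ← integral_const_mul, mul_assoc] using h

/-! ### Convolution on the torus -/

/-- Convolution on the torus. -/
def conv (ρ v : Torus n → ℝ) (x : Torus n) : ℝ := ∫ y, ρ (x - y) * v y

theorem conv_congr_ae {v v' : Torus n → ℝ} (h : v =ᵐ[volume] v') (ρ : Torus n → ℝ) :
    conv ρ v = conv ρ v' := by
  ext x
  exact integral_congr_ae (h.mono fun y hy => by simp only [hy])

theorem integrable_conv_integrand {ρ v : Torus n → ℝ} (hρ : Continuous ρ) (hv : Integrable v)
    (x : Torus n) : Integrable (fun y => ρ (x - y) * v y) := by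
  obtain ⟨C, -, hC⟩ := exists_bound_of_continuous hρ
  exact hv.bdd_mul (hρ.comp (continuous_const.sub continuous_id)).aestronglyMeasurable
    (Eventually.of_forall fun y => hC (x - y))

theorem abs_conv_le {ρ v : Torus n → ℝ} {C : ℝ} (hC : ∀ x, ‖ρ x‖ ≤ C) (hv : Integrable v)
    (x : Torus n) : |conv ρ v x| ≤ C * ∫ y, |v y| := by
  rw [← integral_const_mul, ← Real.norm_eq_abs]
  refine norm_integral_le_of_norm_le (hv.abs.const_mul C) (Eventually.of_forall fun y => ?_)
  rw [norm_mul]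
  exact mul_le_mul_of_nonneg_right (hC _) (norm_nonneg _)

theorem conv_sub {ρ v v' : Torus n → ℝ} (hρ : Continuous ρ) (hv : Integrable v)
    (hv' : Integrable v') (x : Torus n) :
    conv ρ (fun y => v y - v' y) x = conv ρ v x - conv ρ v' x := by
  unfold conv
  rw [← integral_sub (integrable_conv_integrand hρ hv x) (integrable_conv_integrand hρ hv' x)]
  simp only [mul_sub]

theorem conv_neg (ρ v : Torus n → ℝ) (x : Torus n) :
    conv ρ (fun y => -v y) x = -conv ρ v x := by
  unfold conv
  simp only [mul_neg, integral_neg]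

theorem continuous_conv {ρ v : Torus n → ℝ} (hρ : Continuous ρ) (hv : Integrable v) :
    Continuous (conv ρ v) := by
  obtain ⟨C, -, hC⟩ := exists_bound_of_continuous hρ
  refine continuous_of_dominated (bound := fun y => C * |v y|)
    (fun x => (integrable_conv_integrand hρ hv x).aestronglyMeasurable)
    (fun x => Eventually.of_forall fun y => ?_) (hv.abs.const_mul C)
    (Eventually.of_forall fun y => ?_)
  · rw [norm_mul]
    exact mul_le_mul_of_nonneg_right (hC _) (norm_nonneg _)
  · exact (hρ.comp (continuous_id.sub continuous_const)).mul continuous_const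

theorem conv_le {ρ v : Torus n → ℝ} {c : ℝ} (hρ : Continuous ρ) (h0 : ∀ x, 0 ≤ ρ x)
    (h1 : ∫ x, ρ x = 1) (hv : Integrable v) (hc : ∀ᵐ y, v y ≤ c) (x : Torus n) :
    conv ρ v x ≤ c := by
  have h2 : ∫ y, ρ (x - y) * c = c := by
    rw [integral_mul_const, integral_sub_left_eq_self ρ volume x, h1, one_mul]
  rw [← h2]
  refine integral_mono_ae (integrable_conv_integrand hρ hv x)
    (integrable_conv_integrand hρ (integrable_const c) x) (hc.mono fun y hy => ?_)
  exact mul_le_mul_of_nonneg_left hy (h0 _)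

theorem abs_conv_le_of_abs_le {ρ v : Torus n → ℝ} {c : ℝ} (hρ : Continuous ρ)
    (h0 : ∀ x, 0 ≤ ρ x) (h1 : ∫ x, ρ x = 1) (hv : Integrable v) (hc : ∀ᵐ y, |v y| ≤ c)
    (x : Torus n) : |conv ρ v x| ≤ c := by
  rw [abs_le']
  refine ⟨conv_le hρ h0 h1 hv (hc.mono fun y hy => (abs_le'.1 hy).1) x, ?_⟩
  rw [← conv_neg]
  exact conv_le hρ h0 h1 hv.neg (hc.mono fun y hy => (abs_le'.1 hy).2) x

theorem IsSmooth.hasPartial_conv {ρ v : Torus n → ℝ} (hρ : IsSmooth ρ) (hv : Integrable v)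
    (i : Fin n) : HasPartial i (conv ρ v) (conv (TorusHJ.pderiv i ρ) v) := by
  intro x
  have hρ' := (hρ.pderiv i).continuous
  obtain ⟨C, -, hC⟩ := exists_bound_of_continuous hρ'
  let F : ℝ → Torus n → ℝ := fun s y => ρ (x + Pi.single i (s : UnitAddCircle) - y) * v y
  let F' : ℝ → Torus n → ℝ := fun s y =>
    TorusHJ.pderiv i ρ (x + Pi.single i (s : UnitAddCircle) - y) * v y
  have hF : ∀ s, Integrable (F s) := fun s => integrable_conv_integrand hρ.continuous hv _
  have hF' : ∀ s, Integrable (F' s) := fun s => integrable_conv_integrand hρ' hv _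
  have hb : ∀ y s, ‖F' s y‖ ≤ C * |v y| := fun y s => by
    rw [norm_mul]
    exact mul_le_mul_of_nonneg_right (hC _) (norm_nonneg _)
  have hd : ∀ y s, HasDerivAt (fun s => F s y) (F' s y) s := fun y s => by
    have h := ((hρ.hasPartial i).hasDerivAt (x - y) s).mul_const (v y)
    have e : ∀ s : ℝ, x - y + Pi.single i (s : UnitAddCircle) =
        x + Pi.single i (s : UnitAddCircle) - y := fun s => by abel
    simp only [e] at h
    exact h
  have key : HasDerivAt (fun s => ∫ y, F s y) (∫ y, F' 0 y) 0 :=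
    (hasDerivAt_integral_of_dominated_loc_of_deriv_le (s := univ) univ_mem
      (Eventually.of_forall fun s => (hF s).1) (hF 0) (hF' 0).1
      (Eventually.of_forall fun y s _ => hb y s) (hv.abs.const_mul C)
      (Eventually.of_forall fun y s _ => hd y s)).2
  simpa [conv, F, F'] using key

/-- The definition tested with `ρ(x - ·)`; the sign from differentiating `x - y` cancels the one
from integration by parts. -/
theorem IsWeakGradient.conv_pderiv {ρ v : Torus n → ℝ} {G : Torus n → Vec n}
    (h : IsWeakGradient v G) (hρ : IsSmooth ρ) (i : Fin n) (x : Torus n) :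
    conv (TorusHJ.pderiv i ρ) v x = conv ρ (fun y => G y i) x := by
  have h1 := h.2.2 _ (hρ.const_sub x) i
  rw [hρ.pderiv_const_sub] at h1
  simp only [mul_neg, integral_neg, neg_inj] at h1
  simpa only [conv, mul_comm] using h1

theorem lintegral_conv_kernel {ρ : Torus n → ℝ} (hρ : Continuous ρ) (h0 : ∀ x, 0 ≤ ρ x)
    (h1 : ∫ x, ρ x = 1) : ∫⁻ x, ENNReal.ofReal (ρ x) = 1 := by
  rw [← ofReal_integral_eq_lintegral_ofReal (integrable_of_continuous hρ)
    (Eventually.of_forall h0), h1, ENNReal.ofReal_one]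

/-- For fixed `x` the measure `ρ(x - y) dy` is a probability, so its `L¹` norm is at most its `Lᵖ`
norm. Integrating the resulting pointwise bound in `x`, Tonelli and the unit mass of `ρ` conclude.
-/
theorem lintegral_conv_rpow_le {ρ v : Torus n → ℝ} (hρ : Continuous ρ) (h0 : ∀ x, 0 ≤ ρ x)
    (h1 : ∫ x, ρ x = 1) {p : ℝ≥0∞} (hp : 1 ≤ p) (hp' : p ≠ ⊤)
    (hv : AEStronglyMeasurable v) :
    ∫⁻ x, ‖conv ρ v x‖ₑ ^ p.toReal ≤ ∫⁻ x, ‖v x‖ₑ ^ p.toReal := by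
  have hp0 : p ≠ 0 := (zero_lt_one.trans_le hp).ne'
  have hpr : 0 < p.toReal := ENNReal.toReal_pos hp0 hp'
  have hm : ∀ x : Torus n, Measurable fun y => ENNReal.ofReal (ρ (x - y)) := fun x =>
    (ENNReal.continuous_ofReal.comp (hρ.comp (continuous_const.sub continuous_id))).measurable
  have hvm : AEMeasurable (fun y => ‖v y‖ₑ ^ p.toReal) := hv.enorm.pow_const _
  have hpt : ∀ x, ‖conv ρ v x‖ₑ ^ p.toReal ≤
      ∫⁻ y, ENNReal.ofReal (ρ (x - y)) * ‖v y‖ₑ ^ p.toReal := by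
    intro x
    set μ := (volume : Measure (Torus n)).withDensity fun y => ENNReal.ofReal (ρ (x - y)) with hμ
    have : IsProbabilityMeasure μ := by
      refine ⟨?_⟩
      rw [hμ, withDensity_apply _ MeasurableSet.univ, setLIntegral_univ,
        lintegral_sub_left_eq_self (fun y => ENNReal.ofReal (ρ y)) x,
        lintegral_conv_kernel hρ h0 h1]
    have hvμ : AEStronglyMeasurable v μ := hv.mono_ac (withDensity_absolutelyContinuous _ _)
    have e1 : ‖conv ρ v x‖ₑ ≤ eLpNorm v 1 μ := by
      refine (enorm_integral_le_lintegral_enorm _).trans (le_of_eq ?_)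
      rw [eLpNorm_one_eq_lintegral_enorm, hμ,
        lintegral_withDensity_eq_lintegral_mul₀ (hm x).aemeasurable hv.enorm]
      refine lintegral_congr fun y => ?_
      rw [enorm_mul, Pi.mul_apply, Real.enorm_of_nonneg (h0 _)]
    calc ‖conv ρ v x‖ₑ ^ p.toReal ≤ (eLpNorm v p μ) ^ p.toReal :=
          ENNReal.rpow_le_rpow (e1.trans (eLpNorm_le_eLpNorm_of_exponent_le hp hvμ)) hpr.le
      _ = ∫⁻ y, ‖v y‖ₑ ^ p.toReal ∂μ := by
          rw [eLpNorm_eq_lintegral_rpow_enorm_toReal hp0 hp', ← ENNReal.rpow_mul,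
            one_div_mul_cancel hpr.ne', ENNReal.rpow_one]
      _ = _ := by
          rw [hμ, lintegral_withDensity_eq_lintegral_mul₀ (hm x).aemeasurable hvm]
          rfl
  calc ∫⁻ x, ‖conv ρ v x‖ₑ ^ p.toReal
      ≤ ∫⁻ x, ∫⁻ y, ENNReal.ofReal (ρ (x - y)) * ‖v y‖ₑ ^ p.toReal := lintegral_mono hpt
    _ = ∫⁻ y, ∫⁻ x, ENNReal.ofReal (ρ (x - y)) * ‖v y‖ₑ ^ p.toReal := by
        refine lintegral_lintegral_swap (AEMeasurable.mul ?_ ?_)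
        · exact (ENNReal.continuous_ofReal.comp
            (hρ.comp (continuous_fst.sub continuous_snd))).measurable.aemeasurable
        · exact hvm.comp_quasiMeasurePreserving Measure.quasiMeasurePreserving_snd
    _ = ∫⁻ y, ‖v y‖ₑ ^ p.toReal := by
        refine lintegral_congr fun y => ?_
        rw [lintegral_mul_const, lintegral_sub_right_eq_self (fun x => ENNReal.ofReal (ρ x)) y,
          lintegral_conv_kernel hρ h0 h1, one_mul]
        exact (ENNReal.continuous_ofReal.comp
          (hρ.comp (continuous_id.sub continuous_const))).measurable

theorem eLpNorm_conv_le {ρ v : Torus n → ℝ} (hρ : Continuous ρ) (h0 : ∀ x, 0 ≤ ρ x)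
    (h1 : ∫ x, ρ x = 1) {p : ℝ≥0∞} (hp : 1 ≤ p) (hp' : p ≠ ⊤) (hv : AEStronglyMeasurable v) :
    eLpNorm (conv ρ v) p volume ≤ eLpNorm v p volume := by
  have hp0 : p ≠ 0 := (zero_lt_one.trans_le hp).ne'
  rw [eLpNorm_eq_lintegral_rpow_enorm_toReal hp0 hp',
    eLpNorm_eq_lintegral_rpow_enorm_toReal hp0 hp']
  exact ENNReal.rpow_le_rpow (lintegral_conv_rpow_le hρ h0 h1 hp hp' hv) (by positivity)

theorem tendsto_conv_mollifier_of_continuous {g : Torus n → ℝ} (hg : Continuous g)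
    (x : Torus n) : Tendsto (fun m => conv (mollifier m) g x) atTop (𝓝 (g x)) := by
  have h := tendsto_integral_mollifier_mul (g := fun y => g (x - y))
    (hg.comp (continuous_const.sub continuous_id))
  simp only [sub_zero] at h
  refine h.congr fun m => ?_
  unfold conv
  rw [← integral_sub_left_eq_self _ volume x]
  simp only [sub_sub_cancel]

theorem tendsto_eLpNorm_conv_mollifier_of_continuous {g : Torus n → ℝ} (hg : Continuous g)
    {p : ℝ≥0∞} (hp : 1 ≤ p) (hp' : p ≠ ⊤) :
    Tendsto (fun m => eLpNorm (fun x => conv (mollifier m) g x - g x) p volume) atTop (𝓝 0) := by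
  have hp0 : p ≠ 0 := (zero_lt_one.trans_le hp).ne'
  have hpr : 0 < p.toReal := ENNReal.toReal_pos hp0 hp'
  obtain ⟨C, hC0, hC⟩ := exists_bound_of_continuous hg
  have hgi := integrable_of_continuous hg
  have key : Tendsto (fun m => ∫⁻ x, ‖conv (mollifier m) g x - g x‖ₑ ^ p.toReal) atTop
      (𝓝 (∫⁻ _ : Torus n, 0)) := by
    refine tendsto_lintegral_of_dominated_convergence
      (fun _ => (ENNReal.ofReal (C + C)) ^ p.toReal) (fun m => ?_) (fun m => ?_) ?_ ?_
    · exact ((continuous_conv (isSmooth_mollifier m).continuous hgi).sub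
        hg).measurable.enorm.pow_const _
    · refine Eventually.of_forall fun x => ENNReal.rpow_le_rpow ?_ hpr.le
      rw [← ofReal_norm]
      refine ENNReal.ofReal_le_ofReal ((norm_sub_le _ _).trans (add_le_add ?_ (hC x)))
      exact abs_conv_le_of_abs_le (isSmooth_mollifier m).continuous (mollifier_nonneg m)
        (integral_mollifier m) hgi (Eventually.of_forall hC) x
    · simp [hpr.le]
    · refine Eventually.of_forall fun x => ?_
      have h2 := ((tendsto_conv_mollifier_of_continuous hg x).sub_const (g x)).enorm
      rw [sub_self, enorm_zero] at h2
      have h3 := (ENNReal.continuous_rpow_const (y := p.toReal)).tendsto 0 |>.comp h2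
      rwa [ENNReal.zero_rpow_of_pos hpr] at h3
  rw [lintegral_zero] at key
  have h4 := (ENNReal.continuous_rpow_const (y := 1 / p.toReal)).tendsto 0 |>.comp key
  rw [ENNReal.zero_rpow_of_pos (by positivity)] at h4
  refine h4.congr fun m => ?_
  rw [eLpNorm_eq_lintegral_rpow_enorm_toReal hp0 hp']
  rfl

/-- Continuous functions are dense in `Lᵖ`, convergence holds for them, and convolution is an `Lᵖ`
contraction: an `ε/3` argument. -/
theorem tendsto_eLpNorm_conv_mollifier {v : Torus n → ℝ} {p : ℝ≥0∞} (hp : 1 ≤ p) (hp' : p ≠ ⊤)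
    (hv : MemLp v p volume) :
    Tendsto (fun m => eLpNorm (fun x => conv (mollifier m) v x - v x) p volume) atTop (𝓝 0) := by
  rw [ENNReal.tendsto_nhds_zero]
  intro ε hε
  obtain ⟨g, hg, -⟩ := hv.exists_boundedContinuous_eLpNorm_sub_le hp'
    (ENNReal.div_pos hε.ne' (by simp : (3 : ℝ≥0∞) ≠ ⊤)).ne'
  have hgi := integrable_of_continuous g.continuous
  have hvi := hv.integrable hp
  have h3 := ENNReal.tendsto_nhds_zero.1
    (tendsto_eLpNorm_conv_mollifier_of_continuous g.continuous hp hp') (ε / 3)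
    (ENNReal.div_pos hε.ne' (by simp))
  filter_upwards [h3] with m hm
  have hρ := (isSmooth_mollifier (n := n) m).continuous
  have e : (fun x => conv (mollifier m) v x - v x) =
      conv (mollifier m) (v - ⇑g) + ((fun x => conv (mollifier m) g x - g x) + (⇑g - v)) := by
    ext x
    have := conv_sub hρ hvi hgi x
    simp only [Pi.add_apply, Pi.sub_apply]
    change _ = conv (mollifier m) (fun y => v y - g y) x + _
    rw [this]
    ring
  rw [e]
  have m1 : AEStronglyMeasurable (conv (mollifier m) (v - ⇑g)) volume :=
    (continuous_conv hρ (hvi.sub hgi)).aestronglyMeasurable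
  have m2 : AEStronglyMeasurable (fun x => conv (mollifier m) g x - g x) volume :=
    ((continuous_conv hρ hgi).sub g.continuous).aestronglyMeasurable
  have m3 : AEStronglyMeasurable (⇑g - v) volume := hgi.1.sub hv.1
  calc _ ≤ eLpNorm (conv (mollifier m) (v - ⇑g)) p volume +
        (eLpNorm (fun x => conv (mollifier m) g x - g x) p volume + eLpNorm (⇑g - v) p volume) :=
        (eLpNorm_add_le m1 (m2.add m3) hp).trans (by gcongr; exact eLpNorm_add_le m2 m3 hp)
    _ ≤ ε / 3 + (ε / 3 + ε / 3) := by
        gcongr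
        · exact (eLpNorm_conv_le hρ (mollifier_nonneg m) (integral_mollifier m) hp hp'
            (hv.1.sub hgi.1)).trans hg
        · rwa [eLpNorm_sub_comm]
    _ = ε := by rw [← add_assoc, ENNReal.add_thirds]

/-! ### Convolution in the space variable of functions of time and space -/

theorem integrable_conv_prod {X : Type*} [MeasurableSpace X] {ν : Measure X} [SFinite ν]
    {ρ : Torus n → ℝ} (hρ : Continuous ρ)
    {h : X → Torus n → ℝ} (hh : Integrable (fun z : X × Torus n => h z.1 z.2) (ν.prod volume)) :
    Integrable (fun z : X × Torus n => conv ρ (h z.1) z.2) (ν.prod volume) := by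
  obtain ⟨C, hC0, hC⟩ := exists_bound_of_continuous hρ
  have h1 : Integrable (fun p : (X × Torus n) × Torus n => h p.1.1 p.2)
      ((ν.prod volume).prod volume) := by
    have h2 := (MeasurePreserving.prod (measurePreserving_fst (μ := ν)
      (ν := (volume : Measure (Torus n)))) (MeasurePreserving.id (volume : Measure (Torus n))))
    exact h2.integrable_comp_of_integrable hh
  have h2 : Integrable (fun p : (X × Torus n) × Torus n => ρ (p.1.2 - p.2) * h p.1.1 p.2)
      ((ν.prod volume).prod volume) :=
    h1.bdd_mul (hρ.comp_aestronglyMeasurable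
      (by fun_prop : Measurable fun p : (X × Torus n) × Torus n => p.1.2 - p.2).aestronglyMeasurable)
      (Eventually.of_forall fun p => hC _)
  exact h2.integral_prod_left

theorem integrable_conv_left {X : Type*} [MeasurableSpace X] {ν : Measure X} [SFinite ν]
    {ρ : Torus n → ℝ} (hρ : Continuous ρ)
    {h : X → Torus n → ℝ} (hh : Integrable (fun z : X × Torus n => h z.1 z.2) (ν.prod volume))
    (x : Torus n) : Integrable (fun s => conv ρ (h s) x) ν := by
  obtain ⟨C, hC0, hC⟩ := exists_bound_of_continuous hρ
  have h2 : Integrable (fun p : X × Torus n => ρ (x - p.2) * h p.1 p.2) (ν.prod volume) :=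
    hh.bdd_mul (hρ.comp_aestronglyMeasurable
      (by fun_prop : Measurable fun p : X × Torus n => x - p.2).aestronglyMeasurable)
      (Eventually.of_forall fun p => hC _)
  exact h2.integral_prod_left

/-- Convergence holds on almost every slice; dominated convergence in the remaining variable applies
because the slice errors are controlled by the slice norms. -/
theorem tendsto_lintegral_conv_mollifier_sub {X : Type*} [MeasurableSpace X] {ν : Measure X}
    [SFinite ν] [IsFiniteMeasure ν] {h : X → Torus n → ℝ}
    (hh : MemLp (fun z : X × Torus n => h z.1 z.2) 2 (ν.prod volume)) :
    Tendsto (fun m => ∫⁻ z, ‖conv (mollifier m) (h z.1) z.2 - h z.1 z.2‖ₑ ^ (2 : ℝ)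
      ∂(ν.prod volume)) atTop (𝓝 0) := by
  have hm : ∀ m : ℕ, AEMeasurable
      (fun z : X × Torus n => ‖conv (mollifier m) (h z.1) z.2 - h z.1 z.2‖ₑ ^ (2 : ℝ))
      (ν.prod volume) := fun m =>
    ((integrable_conv_prod (isSmooth_mollifier m).continuous
      (hh.integrable one_le_two)).1.sub hh.1).enorm.pow_const _
  have hfin : ∫⁻ z, ‖h z.1 z.2‖ₑ ^ (2 : ℝ) ∂(ν.prod volume) < ⊤ := by
    have := hh.2
    rw [eLpNorm_lt_top_iff_lintegral_rpow_enorm_lt_top two_ne_zero ENNReal.ofNat_ne_top] at this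
    simpa using this
  have hhm : AEMeasurable (fun z : X × Torus n => ‖h z.1 z.2‖ₑ ^ (2 : ℝ)) (ν.prod volume) :=
    hh.1.enorm.pow_const _
  have hmeas : ∀ᵐ s ∂ν, AEStronglyMeasurable (h s) volume := hh.1.prodMk_left
  have hslice : ∀ᵐ s ∂ν, ∫⁻ x, ‖h s x‖ₑ ^ (2 : ℝ) < ⊤ :=
    ae_lt_top' hhm.lintegral_prod_right' (by rw [← lintegral_prod _ hhm]; exact hfin.ne)
  have conv2 : ∀ {v : Torus n → ℝ}, eLpNorm v 2 volume ^ (2 : ℝ) = ∫⁻ x, ‖v x‖ₑ ^ (2 : ℝ) := by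
    intro v
    rw [eLpNorm_eq_lintegral_rpow_enorm_toReal two_ne_zero ENNReal.ofNat_ne_top,
      ← ENNReal.rpow_mul]
    simp
  have key : Tendsto (fun m => ∫⁻ s, ∫⁻ x, ‖conv (mollifier m) (h s) x - h s x‖ₑ ^ (2 : ℝ) ∂volume
      ∂ν) atTop (𝓝 (∫⁻ _ : X, 0 ∂ν)) := by
    refine tendsto_lintegral_of_dominated_convergence'
      -- The factor is `2²`: the triangle inequality and the contraction property bound the slice
      -- error by twice the norm, which is then squared.
      (fun s => 4 * ∫⁻ x, ‖h s x‖ₑ ^ (2 : ℝ)) (fun m => (hm m).lintegral_prod_right')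
      (fun m => ?_) ?_ ?_
    · filter_upwards [hmeas, hslice] with s hs hs'
      have hL : MemLp (h s) 2 volume := ⟨hs, by
        rw [eLpNorm_lt_top_iff_lintegral_rpow_enorm_lt_top two_ne_zero ENNReal.ofNat_ne_top]
        simpa using hs'⟩
      have hρ := (isSmooth_mollifier (n := n) m).continuous
      rw [← conv2, ← conv2]
      have h1 : eLpNorm (fun x => conv (mollifier m) (h s) x - h s x) 2 volume ≤
          2 * eLpNorm (h s) 2 volume := by
        refine (eLpNorm_sub_le (continuous_conv hρ
          (hL.integrable one_le_two)).aestronglyMeasurable hs one_le_two).trans ?_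
        rw [two_mul]
        gcongr
        exact eLpNorm_conv_le hρ (mollifier_nonneg m) (integral_mollifier m) one_le_two
          ENNReal.ofNat_ne_top hs
      refine (ENNReal.rpow_le_rpow h1 (by norm_num)).trans (le_of_eq ?_)
      rw [ENNReal.mul_rpow_of_nonneg _ _ (by norm_num)]
      norm_num
    · rw [lintegral_const_mul' _ _ (by simp), ← lintegral_prod _ hhm]
      exact ENNReal.mul_ne_top (by simp) hfin.ne
    · filter_upwards [hmeas, hslice] with s hs hs'
      have hL : MemLp (h s) 2 volume := ⟨hs, by
        rw [eLpNorm_lt_top_iff_lintegral_rpow_enorm_lt_top two_ne_zero ENNReal.ofNat_ne_top]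
        simpa using hs'⟩
      have h1 := (ENNReal.continuous_rpow_const (y := (2 : ℝ))).tendsto 0 |>.comp
        (tendsto_eLpNorm_conv_mollifier one_le_two ENNReal.ofNat_ne_top hL)
      rw [ENNReal.zero_rpow_of_pos (by norm_num)] at h1
      exact h1.congr fun m => conv2
  rw [lintegral_zero] at key
  exact key.congr fun m => (lintegral_prod _ (hm m)).symm

/-! ### Functions of one real variable -/

theorem AbsolutelyContinuousOnInterval.lipschitzOnWith_comp {f Φ : ℝ → ℝ} {a b : ℝ}
    (hf : AbsolutelyContinuousOnInterval f a b) {K : NNReal} {s : Set ℝ}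
    (hΦ : LipschitzOnWith K Φ s) (hs : MapsTo f (uIcc a b) s) :
    AbsolutelyContinuousOnInterval (fun x => Φ (f x)) a b := by
  rw [absolutelyContinuousOnInterval_iff] at hf ⊢
  intro ε hε
  -- Dividing by `K + 1` rather than `K` covers `K = 0`.
  obtain ⟨δ, hδ, h⟩ := hf (ε / (K + 1)) (by positivity)
  refine ⟨δ, hδ, fun E hE hlt => ?_⟩
  calc ∑ i ∈ Finset.range E.1, dist (Φ (f (E.2 i).1)) (Φ (f (E.2 i).2))
      ≤ ∑ i ∈ Finset.range E.1, K * dist (f (E.2 i).1) (f (E.2 i).2) :=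
        Finset.sum_le_sum fun i hi => hΦ.dist_le_mul _ (hs (hE.1 i hi).1) _ (hs (hE.1 i hi).2)
    _ = K * ∑ i ∈ Finset.range E.1, dist (f (E.2 i).1) (f (E.2 i).2) := by
        rw [Finset.mul_sum]
    _ ≤ K * (ε / (K + 1)) := by gcongr; exact (h E hE hlt).le
    _ < ε := by
        rw [mul_div_assoc', div_lt_iff₀ (by positivity)]
        nlinarith

/-- Since `β` is merely integrable, the chain rule holds only almost everywhere. The integrated form
survives because a locally Lipschitz function of a bounded absolutely continuous one is absolutely
continuous. -/
theorem comp_eq_add_integral {Φ Φ' a β : ℝ → ℝ} {t T : ℝ} (htT : t ≤ T)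
    (hΦ : ∀ r, HasDerivAt Φ (Φ' r) r) (hΦ' : Continuous Φ')
    (hβ : IntervalIntegrable β volume t T)
    (ha : ∀ s ∈ Icc t T, a s = a T + ∫ r in s..T, β r) :
    Φ (a t) = Φ (a T) + ∫ s in t..T, Φ' (a s) * β s := by
  have hsub : ∀ s ∈ Icc t T, IntervalIntegrable β volume t s := fun s hs =>
    hβ.mono_set (by rw [uIcc_of_le hs.1, uIcc_of_le htT]; exact Icc_subset_Icc_right hs.2)
  have hsub' : ∀ s ∈ Icc t T, IntervalIntegrable β volume s T := fun s hs =>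
    hβ.mono_set (by rw [uIcc_of_le hs.2, uIcc_of_le htT]; exact Icc_subset_Icc_left hs.1)
  -- Nothing is known of `a` outside `[t, T]`, so derivatives are taken of this primitive, which
  -- agrees with `a` there.
  set F : ℝ → ℝ := fun s => a t - ∫ r in t..s, β r with hF
  have hFa : ∀ s ∈ Icc t T, F s = a s := by
    intro s hs
    have h1 := ha s hs
    have h2 := ha t ⟨le_rfl, htT⟩
    have h3 := intervalIntegral.integral_add_adjacent_intervals (hsub s hs) (hsub' s hs)
    simp only [hF]
    linarith
  have hc : AbsolutelyContinuousOnInterval (fun _ : ℝ => a t) t T :=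
    (LipschitzWith.const (a t)).lipschitzOnWith.absolutelyContinuousOnInterval
  have hFac : AbsolutelyContinuousOnInterval F t T :=
    hc.sub (hβ.absolutelyContinuousOnInterval_intervalIntegral left_mem_uIcc)
  obtain ⟨R, hR⟩ := hFac.exists_bound
  obtain ⟨C, hC⟩ := (isCompact_Icc (a := -R) (b := R)).exists_bound_of_continuousOn
    hΦ'.continuousOn
  have hlip : LipschitzOnWith (Real.toNNReal C) Φ (Icc (-R) R) :=
    (convex_Icc (-R) R).lipschitzOnWith_of_nnnorm_hasDerivWithin_le
      (fun x _ => (hΦ x).hasDerivWithinAt) fun x hx => by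
        rw [← NNReal.coe_le_coe]
        exact (hC x hx).trans (Real.le_coe_toNNReal C)
  have hcomp := AbsolutelyContinuousOnInterval.lipschitzOnWith_comp hFac hlip
    fun s hs => abs_le.1 (hR s hs)
  have key := hcomp.integral_deriv_eq_sub
  have hd : ∫ s in t..T, deriv (fun x => Φ (F x)) s = ∫ s in t..T, -(Φ' (a s) * β s) := by
    refine intervalIntegral.integral_congr_ae ?_
    filter_upwards [hβ.ae_hasDerivAt_integral] with s hs hs'
    have hs2 := uIoc_subset_uIcc hs'
    have h1 : HasDerivAt F (-β s) s := by
      simpa using (hasDerivAt_const s (a t)).fun_sub (hs hs2 t left_mem_uIcc)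
    have h2 : HasDerivAt (fun x => Φ (F x)) (Φ' (F s) * -β s) s := (hΦ (F s)).comp s h1
    rw [h2.deriv, hFa s (by rwa [uIcc_of_le htT] at hs2), mul_neg]
  rw [hd, intervalIntegral.integral_neg, hFa t ⟨le_rfl, htT⟩, hFa T ⟨htT, le_rfl⟩] at key
  linarith

/-- The derivative of a steep smoothed step at `t` is an approximate identity concentrated just to
the right of `t`. Rescaling gives `∫₀¹ v(t + sτ) S'(s) ds` with `τ = 1/(j+1)`, which is continuous
in `τ`, and `S'` has integral one. -/
theorem tendsto_integral_deriv_smoothTransition {v : ℝ → ℝ} (hv : Continuous v) (t : ℝ) :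
    Tendsto (fun j : ℕ => ∫ s, v s *
      deriv (fun r => Real.smoothTransition (((j : ℝ) + 1) * (r - t))) s) atTop (𝓝 (v t)) := by
  have hS : ContDiff ℝ ∞ Real.smoothTransition := Real.smoothTransition.contDiff
  have hSd : ∀ r, HasDerivAt Real.smoothTransition (deriv Real.smoothTransition r) r := fun r =>
    (hS.differentiable (by simp) r).hasDerivAt
  have hSc : Continuous (deriv Real.smoothTransition) := hS.continuous_deriv (by simp)
  have hS0 : ∀ r, r ∉ Ioc (0 : ℝ) 1 → deriv Real.smoothTransition r = 0 := by
    intro r hr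
    by_cases h : r ≤ 0
    · rcases h.lt_or_eq with h | rfl
      · have : Real.smoothTransition =ᶠ[𝓝 r] fun _ => 0 :=
          (gt_mem_nhds h).mono fun s hs => Real.smoothTransition.zero_of_nonpos (le_of_lt hs)
        rw [this.deriv_eq, deriv_const]
      -- At the corner `0` the two-sided derivative exists by smoothness and equals the left one,
      -- where the function is constant.
      · have h1 : HasDerivWithinAt Real.smoothTransition 0 (Iic (0 : ℝ)) 0 :=
          (hasDerivWithinAt_const (0 : ℝ) (Iic 0) (0 : ℝ)).congr
            (fun s hs => Real.smoothTransition.zero_of_nonpos hs)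
            (Real.smoothTransition.zero_of_nonpos le_rfl)
        exact (uniqueDiffWithinAt_Iic (0 : ℝ)).eq_deriv _ (hSd 0).hasDerivWithinAt h1
    · have h2 : 1 < r := by
        by_contra h3
        exact hr ⟨not_le.1 h, not_lt.1 h3⟩
      have : Real.smoothTransition =ᶠ[𝓝 r] fun _ => 1 :=
        (lt_mem_nhds h2).mono fun s hs => Real.smoothTransition.one_of_one_le (le_of_lt hs)
      rw [this.deriv_eq, deriv_const]
  have e : ∀ j : ℕ, ∫ s, v s *
      deriv (fun r => Real.smoothTransition (((j : ℝ) + 1) * (r - t))) s =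
      ∫ s in (0 : ℝ)..1, v (t + s * ((j : ℝ) + 1)⁻¹) * deriv Real.smoothTransition s := by
    intro j
    have hj : (0 : ℝ) < (j : ℝ) + 1 := by positivity
    have hd : ∀ s, deriv (fun r => Real.smoothTransition (((j : ℝ) + 1) * (r - t))) s =
        deriv Real.smoothTransition (((j : ℝ) + 1) * (s - t)) * ((j : ℝ) + 1) := by
      intro s
      have h1 : HasDerivAt (fun r : ℝ => ((j : ℝ) + 1) * (r - t)) ((j : ℝ) + 1) s := by
        simpa using ((hasDerivAt_id s).sub_const t).const_mul ((j : ℝ) + 1)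
      exact ((hSd _).comp s h1).deriv
    simp only [hd]
    rw [intervalIntegral.integral_of_le zero_le_one,
      setIntegral_eq_integral_of_forall_compl_eq_zero (fun s hs => by rw [hS0 s hs, mul_zero])]
    rw [← integral_add_right_eq_self _ t]
    have h3 := Measure.integral_comp_mul_left
      (fun s => v (t + s * ((j : ℝ) + 1)⁻¹) * deriv Real.smoothTransition s) ((j : ℝ) + 1)
    rw [smul_eq_mul, abs_of_pos (inv_pos.2 hj)] at h3
    rw [← mul_right_inj' (inv_pos.2 hj).ne', ← h3, ← integral_const_mul]
    refine integral_congr_ae (Eventually.of_forall fun s => ?_)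
    have h4 : ((j : ℝ) + 1) * s * ((j : ℝ) + 1)⁻¹ = s := by field_simp
    simp only [h4, add_sub_cancel_right, add_comm t s]
    field_simp
  have hcont : Continuous fun τ : ℝ =>
      ∫ s in (0 : ℝ)..1, v (t + s * τ) * deriv Real.smoothTransition s :=
    intervalIntegral.continuous_parametric_intervalIntegral_of_continuous'
      (by unfold Function.uncurry; fun_prop) _ _
  have h0 : ∫ s in (0 : ℝ)..1, v (t + s * 0) * deriv Real.smoothTransition s = v t := by
    simp only [mul_zero, add_zero]
    rw [intervalIntegral.integral_const_mul,
      intervalIntegral.integral_eq_sub_of_hasDerivAt (fun x _ => hSd x)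
        (hSc.intervalIntegrable _ _)]
    simp
  have hτ : Tendsto (fun j : ℕ => ((j : ℝ) + 1)⁻¹) atTop (𝓝 0) := by
    simpa using tendsto_one_div_add_atTop_nhds_zero_nat (𝕜 := ℝ)
  have h5 := (hcont.tendsto 0).comp hτ
  rw [h0] at h5
  exact h5.congr fun j => (e j).symm

/-- The hypothesis says `v' = -α` weakly. It is tested with the difference of two smoothed steps, at
`t₁` and `t₂`, which approximates the indicator of `(t₁, t₂]`. -/
theorem sub_eq_integral_of_weak_deriv {T : ℝ} {v α : ℝ → ℝ} (hv : Continuous v)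
    (hα : IntegrableOn α (Ioo 0 T))
    (H : ∀ η : ℝ → ℝ, ContDiff ℝ ∞ η → ∀ a b, 0 < a → b < T → (∀ t, t ∉ Icc a b → η t = 0) →
      ∫ t in Ioo 0 T, v t * deriv η t = ∫ t in Ioo 0 T, α t * η t)
    {t₁ t₂ : ℝ} (h₁ : 0 < t₁) (h₁₂ : t₁ ≤ t₂) (h₂ : t₂ < T) :
    v t₁ - v t₂ = ∫ t in t₁..t₂, α t := by
  have hS : ContDiff ℝ ∞ Real.smoothTransition := Real.smoothTransition.contDiff
  let S : ℕ → ℝ → ℝ → ℝ := fun j t r => Real.smoothTransition (((j : ℝ) + 1) * (r - t))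
  have hSs : ∀ j t, ContDiff ℝ ∞ (S j t) := fun j t =>
    hS.comp (contDiff_const.mul (contDiff_id.sub contDiff_const))
  have hS0 : ∀ j t r, r ≤ t → S j t r = 0 := fun j t r h =>
    Real.smoothTransition.zero_of_nonpos
      (mul_nonpos_of_nonneg_of_nonpos (by positivity) (sub_nonpos.2 h))
  have hS1 : ∀ (j : ℕ) t r, 1 ≤ ((j : ℝ) + 1) * (r - t) → S j t r = 1 := fun j t r h =>
    Real.smoothTransition.one_of_one_le h
  have hlarge : ∀ {c d : ℝ}, c < d → ∀ᶠ j : ℕ in atTop, 1 ≤ ((j : ℝ) + 1) * (d - c) := by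
    intro c d hcd
    have h1 : Tendsto (fun j : ℕ => ((j : ℝ) + 1) * (d - c)) atTop atTop :=
      (tendsto_atTop_add_const_right _ _ tendsto_natCast_atTop_atTop).atTop_mul_const
        (sub_pos.2 hcd)
    exact h1.eventually_ge_atTop 1
  let η : ℕ → ℝ → ℝ := fun j r => S j t₁ r - S j t₂ r
  have hηd : ∀ j r, deriv (η j) r = deriv (S j t₁) r - deriv (S j t₂) r := fun j r =>
    deriv_fun_sub ((hSs j t₁).differentiable (by simp) r) ((hSs j t₂).differentiable (by simp) r)
  -- Room between `t₂` and `T` for the second step to be completed, once `j` is large, inside a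
  -- compact subset of `(0, T)`.
  set b := (t₂ + T) / 2 with hb
  have hη0 : ∀ᶠ j : ℕ in atTop, ∀ r, r ∉ Icc t₁ b → η j r = 0 := by
    filter_upwards [hlarge (show t₂ < b by linarith)] with j hj r hr
    by_cases h : r < t₁
    · simp only [η, hS0 j t₁ r h.le, hS0 j t₂ r (h.le.trans h₁₂), sub_zero]
    · have h' : b < r := by
        by_contra h3
        exact hr ⟨not_lt.1 h, not_lt.1 h3⟩
      have hj0 : (0 : ℝ) < (j : ℝ) + 1 := by positivity
      have e2 : 1 ≤ ((j : ℝ) + 1) * (r - t₂) := hj.trans (by gcongr)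
      have e1 : 1 ≤ ((j : ℝ) + 1) * (r - t₁) := e2.trans (by gcongr)
      simp only [η, hS1 j t₁ r e1, hS1 j t₂ r e2, sub_self]
  have hcs : ∀ᶠ j : ℕ in atTop, ∫ t in Ioo 0 T, v t * deriv (η j) t =
      (∫ s, v s * deriv (S j t₁) s) - ∫ s, v s * deriv (S j t₂) s := by
    -- A single step is not compactly supported but its derivative is; hence the integral can be
    -- split in two over the whole line.
    filter_upwards [hη0, hlarge (show t₂ < b by linarith)] with j hj hj2
    have hout : ∀ t, t ≤ t₂ → t₁ ≤ t → ∀ r, r ∉ Icc t₁ b → deriv (S j t) r = 0 := by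
      intro t ht ht' r hr
      by_cases h : r < t₁
      · have : S j t =ᶠ[𝓝 r] fun _ => 0 :=
          (gt_mem_nhds h).mono fun s hs => hS0 j t s (hs.le.trans ht')
        rw [this.deriv_eq, deriv_const]
      · have h' : b < r := by
          by_contra h3
          exact hr ⟨not_lt.1 h, not_lt.1 h3⟩
        have : S j t =ᶠ[𝓝 r] fun _ => 1 := by
          filter_upwards [lt_mem_nhds h'] with s hs
          have hj0 : (0 : ℝ) < (j : ℝ) + 1 := by positivity
          exact hS1 j t s (hj2.trans (by gcongr))
        rw [this.deriv_eq, deriv_const]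
    have hint : ∀ t, t ≤ t₂ → t₁ ≤ t → Integrable fun s => v s * deriv (S j t) s := by
      intro t ht ht'
      have hc : Continuous fun s => v s * deriv (S j t) s :=
        hv.mul ((hSs j t).continuous_deriv (by simp))
      exact hc.integrable_of_hasCompactSupport (HasCompactSupport.intro isCompact_Icc
        fun r hr => by rw [hout t ht ht' r hr, mul_zero])
    rw [← integral_sub (hint _ h₁₂ le_rfl) (hint _ le_rfl h₁₂),
      setIntegral_eq_integral_of_forall_compl_eq_zero]
    · refine integral_congr_ae (Eventually.of_forall fun s => ?_)
      simp only [hηd, mul_sub]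
    · intro r hr
      have hr' : r ∉ Icc t₁ b := fun h => hr ⟨h₁.trans_le h.1, h.2.trans_lt (by linarith)⟩
      rw [hηd, hout _ h₁₂ le_rfl r hr', hout _ le_rfl h₁₂ r hr', sub_self, mul_zero]
  have lim1 : Tendsto (fun j => ∫ t in Ioo 0 T, v t * deriv (η j) t) atTop
      (𝓝 (v t₁ - v t₂)) :=
    ((tendsto_integral_deriv_smoothTransition hv t₁).sub
      (tendsto_integral_deriv_smoothTransition hv t₂)).congr' (hcs.mono fun j hj => hj.symm)
  have lim2 : Tendsto (fun j => ∫ t in Ioo 0 T, α t * η j t) atTop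
      (𝓝 (∫ t in Ioo 0 T, (Ioc t₁ t₂).indicator α t)) := by
    refine tendsto_integral_of_dominated_convergence (fun t => |α t|) (fun j => ?_) hα.abs
      (fun j => Eventually.of_forall fun t => ?_) (Eventually.of_forall fun t => ?_)
    · exact hα.1.mul ((hSs j t₁).continuous.sub (hSs j t₂).continuous).aestronglyMeasurable
    · rw [norm_mul]
      refine mul_le_of_le_one_right (norm_nonneg _) ?_
      rw [Real.norm_eq_abs, abs_le]
      have := Real.smoothTransition.le_one (((j : ℝ) + 1) * (t - t₁))
      have := Real.smoothTransition.nonneg (((j : ℝ) + 1) * (t - t₁))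
      have := Real.smoothTransition.le_one (((j : ℝ) + 1) * (t - t₂))
      have := Real.smoothTransition.nonneg (((j : ℝ) + 1) * (t - t₂))
      simp only [η, S]
      constructor <;> linarith
    · refine tendsto_nhds_of_eventually_eq ?_
      rcases le_or_gt t t₁ with h | h
      · refine Eventually.of_forall fun j => ?_
        rw [indicator_of_notMem (fun h' => absurd h'.1 (not_lt.2 h))]
        simp only [η, hS0 j t₁ t h, hS0 j t₂ t (h.trans h₁₂), sub_zero, mul_zero]
      · rcases le_or_gt t t₂ with h' | h'
        · filter_upwards [hlarge h] with j hj
          rw [indicator_of_mem (show t ∈ Ioc t₁ t₂ from ⟨h, h'⟩)]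
          simp only [η, hS1 j t₁ t hj, hS0 j t₂ t h', sub_zero, mul_one]
        · filter_upwards [hlarge h, hlarge h'] with j hj hj'
          rw [indicator_of_notMem (fun h'' => absurd h''.2 (not_le.2 h'))]
          simp only [η, hS1 j t₁ t hj, hS1 j t₂ t hj', sub_self, mul_zero]
  have heq : ∀ᶠ j : ℕ in atTop, ∫ t in Ioo 0 T, v t * deriv (η j) t =
      ∫ t in Ioo 0 T, α t * η j t :=
    hη0.mono fun j hj => H (η j) ((hSs j t₁).sub (hSs j t₂)) t₁ b h₁ (by linarith) hj
  rw [tendsto_nhds_unique (lim1.congr' heq) lim2, intervalIntegral.integral_of_le h₁₂,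
    setIntegral_indicator measurableSet_Ioc]
  congr 2
  refine inter_eq_right.2 fun t ht => ⟨h₁.trans ht.1, ht.2.trans_lt h₂⟩

/-- Test functions do not see the end point `T`; continuity of both sides on `[t, T]` reaches it.
This is where the terminal value enters the equation. -/
theorem sub_eq_integral_of_weak_deriv_right {T : ℝ} {v α : ℝ → ℝ} (hv : Continuous v)
    (hα : IntegrableOn α (Ioo 0 T))
    (H : ∀ η : ℝ → ℝ, ContDiff ℝ ∞ η → ∀ a b, 0 < a → b < T → (∀ t, t ∉ Icc a b → η t = 0) →
      ∫ t in Ioo 0 T, v t * deriv η t = ∫ t in Ioo 0 T, α t * η t)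
    {t : ℝ} (h₀ : 0 < t) (hT : t ≤ T) :
    v t = v T + ∫ s in t..T, α s := by
  rcases hT.lt_or_eq with hT | rfl
  swap
  · simp
  have hα' : IntegrableOn α (uIcc t T) := by
    rw [uIcc_of_le hT.le, integrableOn_Icc_iff_integrableOn_Ioo]
    exact hα.mono_set (Ioo_subset_Ioo_left h₀.le)
  have h1 : ContinuousOn (fun s => v t - v s - ∫ r in t..s, α r) (Icc t T) := by
    have := intervalIntegral.continuousOn_primitive_interval hα'
    rw [uIcc_of_le hT.le] at this
    exact (continuousOn_const.sub hv.continuousOn).sub this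
  have h2 : EqOn (fun s => v t - v s - ∫ r in t..s, α r) (fun _ => 0) (Ico t T) := fun s hs => by
    simp only [sub_eq_integral_of_weak_deriv hv hα H h₀ hs.1 hs.2, sub_self]
  have h3 := h2.of_subset_closure h1 continuousOn_const Ico_subset_Icc_self
    (by rw [closure_Ico hT.ne]) ⟨hT.le, le_rfl⟩
  simp only at h3
  linarith

/-- Backward Grönwall: the hypothesis makes `(A + C ∫ₛᵀ E) e^{Cs}` nondecreasing in `s`. -/
theorem le_mul_exp_of_le_add_integral {E : ℝ → ℝ} {A C t T : ℝ} (htT : t ≤ T)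
    (hE : Continuous E) (hC : 0 ≤ C) (h : ∀ s ∈ Icc t T, E s ≤ A + C * ∫ r in s..T, E r) :
    E t ≤ A * Real.exp (C * (T - t)) := by
  have hI : ∀ s, HasDerivAt (fun s => ∫ r in s..T, E r) (-E s) s := fun s =>
    intervalIntegral.integral_hasDerivAt_left (hE.intervalIntegrable _ _)
      hE.stronglyMeasurable.stronglyMeasurableAtFilter hE.continuousAt
  have hg : ∀ s, HasDerivAt (fun s => (A + C * ∫ r in s..T, E r) * Real.exp (C * s))
      ((C * -E s) * Real.exp (C * s) + (A + C * ∫ r in s..T, E r) * (Real.exp (C * s) * C)) s := by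
    intro s
    have h1 : HasDerivAt (fun s => Real.exp (C * s)) (Real.exp (C * s) * C) s := by
      simpa using ((hasDerivAt_id s).const_mul C).exp
    exact (((hI s).const_mul C).const_add A).fun_mul h1
  have hmono : MonotoneOn (fun s => (A + C * ∫ r in s..T, E r) * Real.exp (C * s)) (Icc t T) := by
    refine monotoneOn_of_deriv_nonneg (convex_Icc t T)
      (fun s _ => (hg s).continuousAt.continuousWithinAt)
      (fun s _ => (hg s).differentiableAt.differentiableWithinAt) fun s hs => ?_
    rw [interior_Icc] at hs
    rw [(hg s).deriv]
    have h1 := h s ⟨hs.1.le, hs.2.le⟩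
    have h2 : 0 ≤ C * Real.exp (C * s) * ((A + C * ∫ r in s..T, E r) - E s) :=
      mul_nonneg (by positivity) (sub_nonneg.2 h1)
    linarith
  have h2 := hmono ⟨le_rfl, htT⟩ ⟨htT, le_rfl⟩ htT
  simp only [intervalIntegral.integral_same, mul_zero, add_zero] at h2
  refine (h t ⟨le_rfl, htT⟩).trans ?_
  rw [mul_sub, Real.exp_sub, mul_div_assoc', le_div_iff₀ (Real.exp_pos _)]
  exact h2

/-! ### A convex function vanishing exactly on the nonpositive numbers -/

/-- The condition `g' 0 = 0` makes the one-sided derivatives at the corner agree. -/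
theorem hasDerivAt_comp_max {g g' : ℝ → ℝ} (hg : ∀ p, 0 ≤ p → HasDerivAt g (g' p) p)
    (h0 : g' 0 = 0) (s : ℝ) : HasDerivAt (fun s => g (max s 0)) (g' (max s 0)) s := by
  rcases lt_trichotomy s 0 with h | rfl | h
  · rw [max_eq_right h.le, h0]
    refine (hasDerivAt_const s (g 0)).congr_of_eventuallyEq ?_
    filter_upwards [gt_mem_nhds h] with r hr
    rw [max_eq_right (le_of_lt hr)]
  · rw [max_self, h0]
    have h1 : HasDerivWithinAt (fun s => g (max s 0)) 0 (Iic 0) 0 :=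
      (hasDerivWithinAt_const (0 : ℝ) (Iic 0) (g 0)).congr
        (fun r hr => by rw [max_eq_right (mem_Iic.1 hr)]) (by rw [max_self])
    have h2 : HasDerivWithinAt (fun s => g (max s 0)) 0 (Ici 0) 0 := by
      have := (hg 0 le_rfl).hasDerivWithinAt (s := Ici 0)
      rw [h0] at this
      exact this.congr (fun r hr => by rw [max_eq_left (mem_Ici.1 hr)]) (by rw [max_self])
    have h3 := h1.union h2
    rwa [Iic_union_Ici, hasDerivWithinAt_univ] at h3
  · rw [max_eq_left h.le]
    refine (hg s h.le).congr_of_eventuallyEq ?_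
    filter_upwards [lt_mem_nhds h] with r hr
    rw [max_eq_left (le_of_lt hr)]

/-- The function `p³ / (1 + p)` of the positive part `p`. -/
def penalty (s : ℝ) : ℝ := max s 0 ^ 3 / (1 + max s 0)

/-- The derivative of `penalty`. -/
def penalty' (s : ℝ) : ℝ := max s 0 ^ 2 * (3 + 2 * max s 0) / (1 + max s 0) ^ 2

/-- The second derivative of `penalty`. -/
def penalty'' (s : ℝ) : ℝ :=
  2 * max s 0 * (3 + 3 * max s 0 + max s 0 ^ 2) / (1 + max s 0) ^ 3

theorem hasDerivAt_penalty (s : ℝ) : HasDerivAt penalty (penalty' s) s := by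
  refine hasDerivAt_comp_max (g := fun p => p ^ 3 / (1 + p))
    (g' := fun p => p ^ 2 * (3 + 2 * p) / (1 + p) ^ 2) (fun p hp => ?_) (by simp) s
  have h1 : (1 + p) ≠ 0 := by positivity
  refine ((hasDerivAt_pow 3 p).fun_div ((hasDerivAt_id' p).const_add 1) h1).congr_deriv ?_
  push_cast
  ring

theorem hasDerivAt_penalty' (s : ℝ) : HasDerivAt penalty' (penalty'' s) s := by
  refine hasDerivAt_comp_max (g := fun p => p ^ 2 * (3 + 2 * p) / (1 + p) ^ 2)
    (g' := fun p => 2 * p * (3 + 3 * p + p ^ 2) / (1 + p) ^ 3) (fun p hp => ?_) (by simp) s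
  have h1 : (1 + p) ≠ 0 := by positivity
  refine (((hasDerivAt_pow 2 p).fun_mul (((hasDerivAt_id' p).const_mul 2).const_add 3)).fun_div
    (((hasDerivAt_id' p).const_add 1).fun_pow 2) (pow_ne_zero 2 h1)).congr_deriv ?_
  push_cast
  field_simp
  ring

theorem continuous_penalty : Continuous penalty :=
  continuous_iff_continuousAt.2 fun s => (hasDerivAt_penalty s).continuousAt

theorem continuous_penalty' : Continuous penalty' :=
  continuous_iff_continuousAt.2 fun s => (hasDerivAt_penalty' s).continuousAt

theorem continuous_penalty'' : Continuous penalty'' := by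
  unfold penalty''
  refine Continuous.div (by fun_prop) (by fun_prop) fun s => ?_
  have := le_max_right s 0
  positivity

theorem penalty_nonneg (s : ℝ) : 0 ≤ penalty s := by
  have := le_max_right s 0
  unfold penalty
  positivity

theorem penalty'_nonneg (s : ℝ) : 0 ≤ penalty' s := by
  have := le_max_right s 0
  unfold penalty'
  positivity

theorem penalty''_nonneg (s : ℝ) : 0 ≤ penalty'' s := by
  have := le_max_right s 0
  unfold penalty''
  positivity

theorem penalty_eq_zero_iff {s : ℝ} : penalty s = 0 ↔ s ≤ 0 := by
  have h := le_max_right s 0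
  have h1 : (1 + max s 0) ≠ 0 := by positivity
  unfold penalty
  rw [div_eq_zero_iff, or_iff_left h1, pow_eq_zero_iff three_ne_zero, max_eq_right_iff]

/-- This needs at most quadratic growth, which rules out a pure cubic, while C² regularity at `0`
rules out the squared positive part. The quotient `p³/(1+p)` is cubic near `0` and quadratic at
infinity. -/
theorem penalty'_sq_le (s : ℝ) : penalty' s ^ 2 ≤ 4 * penalty s := by
  have hp := le_max_right s 0
  unfold penalty' penalty
  generalize max s 0 = p at *
  rw [div_pow, ← mul_div_assoc, div_le_div_iff₀ (by positivity) (by positivity)]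
  have : 4 * p ^ 3 * ((1 + p) ^ 2) ^ 2 - (p ^ 2 * (3 + 2 * p)) ^ 2 * (1 + p) =
      p ^ 3 * (1 + p) * (4 + 3 * p) := by ring
  have : 0 ≤ p ^ 3 * (1 + p) * (4 + 3 * p) := by positivity
  linarith

/-- Where the penalty is positive, this expresses convexity of its square root. -/
theorem penalty'_sq_le_mul (s : ℝ) : penalty' s ^ 2 ≤ 2 * penalty s * penalty'' s := by
  have hp := le_max_right s 0
  unfold penalty' penalty penalty''
  generalize max s 0 = p at *
  have e : 2 * (p ^ 3 / (1 + p)) * (2 * p * (3 + 3 * p + p ^ 2) / (1 + p) ^ 3) =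
      2 * p ^ 3 * (2 * p * (3 + 3 * p + p ^ 2)) / ((1 + p) * (1 + p) ^ 3) := by
    rw [← mul_div_assoc 2, div_mul_div_comm]
  rw [e, div_pow, div_le_div_iff₀ (by positivity) (by positivity)]
  have : 2 * p ^ 3 * (2 * p * (3 + 3 * p + p ^ 2)) * ((1 + p) ^ 2) ^ 2 -
      (p ^ 2 * (3 + 2 * p)) ^ 2 * ((1 + p) * (1 + p) ^ 3) = 3 * p ^ 4 * (1 + p) ^ 4 := by ring
  have : 0 ≤ 3 * p ^ 4 * (1 + p) ^ 4 := by positivity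
  linarith

/-- Young's inequality twice. Here `d` is the size of the mollified gradient, whose contribution
goes into the diffusion term, and `r` is the mollification error, of which only the square remains.
-/
theorem penalty'_mul_le {ε : ℝ} (hε : 0 < ε) (M s r d : ℝ) :
    penalty' s * (r + M * d) ≤
      ε * penalty'' s * d ^ 2 + (1 + M ^ 2 / (2 * ε)) * penalty s + r ^ 2 := by
  have h1 : penalty' s * r ≤ penalty s + r ^ 2 := by
    nlinarith [sq_nonneg (penalty' s - 2 * r), penalty'_sq_le s]
  have h2 : penalty' s * (M * d) ≤ ε * penalty'' s * d ^ 2 + M ^ 2 / (2 * ε) * penalty s := by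
    have hP := penalty_nonneg s
    have hP'' := penalty''_nonneg s
    have hX : 0 ≤ ε * penalty'' s * d ^ 2 := by positivity
    have hY : 0 ≤ M ^ 2 / (2 * ε) * penalty s := by positivity
    refine (le_abs_self _).trans (abs_le_of_sq_le_sq ?_ (by positivity))
    have h3 : (penalty' s * (M * d)) ^ 2 ≤ 2 * penalty s * penalty'' s * (M * d) ^ 2 := by
      rw [mul_pow]
      exact mul_le_mul_of_nonneg_right (penalty'_sq_le_mul s) (sq_nonneg _)
    -- With `X` and `Y` the two terms of the bound, the square of the left side is at most `4XY ≤ (X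
    -- + Y)²`; this fixes the constant `M²/(2ε)`.
    have h4 : 4 * (ε * penalty'' s * d ^ 2) * (M ^ 2 / (2 * ε) * penalty s) =
        2 * penalty s * penalty'' s * (M * d) ^ 2 := by
      field_simp
      ring
    nlinarith [sq_nonneg (ε * penalty'' s * d ^ 2 - M ^ 2 / (2 * ε) * penalty s)]
  linarith

/-! ### Mollification of the equation -/

theorem integral_abs_le_norm_Lp (u : Lp ℝ 2 (volume : Measure (Torus n))) :
    ∫ y, |u y| ≤ ‖u‖ := by
  have h1 := eLpNorm_le_eLpNorm_of_exponent_le (μ := (volume : Measure (Torus n)))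
    (one_le_two : (1 : ℝ≥0∞) ≤ 2) (Lp.memLp u).1
  have h2 : ∫ y, |u y| = (eLpNorm u 1 volume).toReal := by
    rw [eLpNorm_one_eq_lintegral_enorm]
    exact integral_norm_eq_lintegral_enorm (Lp.memLp u).1
  rw [h2, Lp.norm_def]
  exact ENNReal.toReal_mono (Lp.memLp u).2.ne h1

theorem integrable_Lp (u : Lp ℝ 2 (volume : Measure (Torus n))) : Integrable u :=
  (Lp.memLp u).integrable one_le_two

/-- Convolution with a continuous kernel is continuous in `x` for each `u`, and Lipschitz in `u ∈
L²` uniformly in `x`. -/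
theorem continuous_conv_uncurry {X : Type*} [TopologicalSpace X] {ρ : Torus n → ℝ}
    (hρ : Continuous ρ) {W : X → Lp ℝ 2 (volume : Measure (Torus n))} (hW : Continuous W) :
    Continuous fun z : X × Torus n => conv ρ (W z.1) z.2 := by
  obtain ⟨C, hC0, hC⟩ := exists_bound_of_continuous hρ
  have h : Continuous fun z : Torus n × Lp ℝ 2 (volume : Measure (Torus n)) =>
      conv ρ z.2 z.1 := by
    refine continuous_prod_of_continuous_lipschitzWith' _ (Real.toNNReal C)
      (fun x => LipschitzWith.of_dist_le_mul fun u u' => ?_)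
      (fun u => continuous_conv hρ (integrable_Lp u))
    rw [Real.dist_eq, dist_eq_norm, ← conv_sub hρ (integrable_Lp u) (integrable_Lp u'),
      show conv ρ (fun y => u y - u' y) = conv ρ ⇑(u - u') from
        conv_congr_ae (Lp.coeFn_sub u u').symm ρ, Real.coe_toNNReal C hC0]
    exact (abs_conv_le hC (integrable_Lp _) x).trans
      (mul_le_mul_of_nonneg_left (integral_abs_le_norm_Lp _) hC0)
  exact h.comp (continuous_snd.prodMk (hW.comp continuous_fst))

theorem conv_laplacian {ρ v : Torus n → ℝ} (hρ : IsSmooth ρ) (hv : Integrable v) (x : Torus n) :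
    conv (laplacian ρ) v x = ∑ i, conv (pderiv i (pderiv i ρ)) v x := by
  unfold conv laplacian
  rw [← integral_finsetSum _ fun i _ =>
    integrable_conv_integrand ((hρ.pderiv i).pderiv i).continuous hv x]
  simp only [Finset.sum_mul]

/-- The equation `-∂ₜw - εΔw + h = f` in the sense of distributions on `Q_T`, with
`w ∈ C([0,T]; L²)` and spatial gradient `D ∈ L²(Q_T)`. -/
structure IsLinearSolution (ε T : ℝ) (w h f : ℝ → Torus n → ℝ) (D : ℝ → Torus n → Vec n)
    (W : ℝ → Lp ℝ 2 (volume : Measure (Torus n))) : Prop where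
  continuous : Continuous W
  ae_eq : ∀ t ∈ Icc 0 T, W t =ᵐ[volume] w t
  memLp : MemLp (fun z : ℝ × Torus n => w z.1 z.2) 2 (cyl n T)
  memLp_grad : MemLp (fun z : ℝ × Torus n => D z.1 z.2) 2 (cyl n T)
  isWeakGradient : ∀ᵐ t ∂(volume.restrict (Ioo 0 T)), IsWeakGradient (w t) (D t)
  memLp_h : MemLp (fun z : ℝ × Torus n => h z.1 z.2) 2 (cyl n T)
  integrable_f : Integrable (fun z : ℝ × Torus n => f z.1 z.2) (cyl n T)
  equation : ∀ φ : ℝ → Torus n → ℝ, IsTestFunction T φ →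
    ∫ z, (w z.1 z.2 * deriv (fun s => φ s z.2) z.1
        + ε * ∑ i, D z.1 z.2 i * pderiv i (φ z.1) z.2
        + h z.1 z.2 * φ z.1 z.2) ∂(cyl n T)
      = ∫ z, f z.1 z.2 * φ z.1 z.2 ∂(cyl n T)

instance (T : ℝ) : IsFiniteMeasure (cyl n T) := by
  unfold cyl
  infer_instance

namespace IsLinearSolution

variable {ε T : ℝ} {w h f : ℝ → Torus n → ℝ} {D : ℝ → Torus n → Vec n}
  {W : ℝ → Lp ℝ 2 (volume : Measure (Torus n))}

theorem memLp_grad_apply (hw : IsLinearSolution ε T w h f D W) (i : Fin n) :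
    MemLp (fun z : ℝ × Torus n => D z.1 z.2 i) 2 (cyl n T) :=
  hw.memLp_grad.continuousLinearMap_comp (EuclideanSpace.proj (𝕜 := ℝ) i)

theorem conv_eq (hw : IsLinearSolution ε T w h f D W) {t : ℝ} (ht : t ∈ Icc 0 T)
    (ρ : Torus n → ℝ) : conv ρ (W t) = conv ρ (w t) :=
  conv_congr_ae (hw.ae_eq t ht) ρ

theorem integrable_conv_rhs (hw : IsLinearSolution ε T w h f D W) {ρ : Torus n → ℝ}
    (hρ : IsSmooth ρ) (x : Torus n) : IntegrableOn (fun s => ε * conv (laplacian ρ) (w s) x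
      - conv ρ (h s) x + conv ρ (f s) x) (Ioo 0 T) :=
  (((integrable_conv_left hρ.laplacian.continuous (hw.memLp.integrable one_le_two) x).const_mul
    ε).sub (integrable_conv_left hρ.continuous (hw.memLp_h.integrable one_le_two) x)).add
    (integrable_conv_left hρ.continuous hw.integrable_f x)

/-- Testing with `η(s) ρ(x - y)` gives, for each fixed `x`, a weak ordinary differential equation in
time. The weak gradient is moved back onto the kernel, which produces `Δρ ∗ w`. -/
theorem conv_eq_add_integral (hw : IsLinearSolution ε T w h f D W) {ρ : Torus n → ℝ}
    (hρ : IsSmooth ρ) (x : Torus n) {t : ℝ} (h0 : 0 < t) (hT : t ≤ T) :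
    conv ρ (W t) x = conv ρ (W T) x + ∫ s in t..T, (ε * conv (laplacian ρ) (w s) x
      - conv ρ (h s) x + conv ρ (f s) x) := by
  have hVc : Continuous fun s => conv ρ (W s) x :=
    (continuous_conv_uncurry hρ.continuous hw.continuous).comp
      (continuous_id.prodMk continuous_const)
  refine sub_eq_integral_of_weak_deriv_right hVc (hw.integrable_conv_rhs hρ x) ?_ h0 hT
  intro η hη a b ha hb hs
  have hint := hw.integrable_conv_rhs hρ x
  have hκ := hρ.const_sub x
  have hbdd : ∀ {g : ℝ → ℝ}, Continuous g → ∃ C, ∀ᵐ z ∂(cyl n T), ‖g z.1‖ ≤ C := by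
    intro g hg
    obtain ⟨C, hC⟩ := isCompact_Icc.exists_bound_of_continuousOn (s := Icc 0 T) hg.continuousOn
    have h1 : ∀ᵐ t ∂(volume.restrict (Ioo 0 T)), ‖g t‖ ≤ C := by
      filter_upwards [ae_restrict_mem measurableSet_Ioo] with t ht
      exact hC t ⟨ht.1.le, ht.2.le⟩
    exact ⟨C, Measure.quasiMeasurePreserving_fst.ae h1⟩
  have hprod : ∀ {q : ℝ × Torus n → ℝ} {g : ℝ → ℝ} {κ : Torus n → ℝ}, Integrable q (cyl n T) →
      Continuous g → Continuous κ → Integrable (fun z => q z * (g z.1 * κ z.2)) (cyl n T) := by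
    intro q g κ hq hg hκ
    obtain ⟨C, hC⟩ := hbdd hg
    obtain ⟨C', -, hC'⟩ := exists_bound_of_continuous hκ
    refine hq.mul_bdd (c := C * C') ?_ ?_
    · exact ((hg.comp continuous_fst).mul (hκ.comp continuous_snd)).aestronglyMeasurable
    · filter_upwards [hC] with z hz
      rw [norm_mul]
      exact mul_le_mul hz (hC' _) (norm_nonneg _) ((norm_nonneg _).trans hz)
  have hη' : Continuous (deriv η) := hη.continuous_deriv (by simp)
  have key := hw.equation _ (hκ.isTestFunction hη ha hb hs)
  have d1 : ∀ (t : ℝ) (y : Torus n), deriv (fun s => η s * ρ (x - y)) t =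
      deriv η t * ρ (x - y) := fun t y =>
    deriv_mul_const (hη.differentiable (by simp) t) _
  have d2 : ∀ (t : ℝ) (i : Fin n) (y : Torus n), pderiv i (fun y => η t * ρ (x - y)) y =
      η t * -pderiv i ρ (x - y) := fun t i y =>
    ((hρ.hasPartial_const_sub i x y).const_mul (η t)).deriv
  simp only [d1, d2] at key
  have iw := hw.memLp.integrable one_le_two
  have ih := hw.memLp_h.integrable one_le_two
  have iD := fun i => (hw.memLp_grad_apply i).integrable one_le_two
  have ρc : Continuous fun y => ρ (x - y) := hκ.continuous
  have ρc' : ∀ i, Continuous fun y => -pderiv i ρ (x - y) := fun i =>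
    ((hρ.pderiv i).const_sub x).continuous.neg
  have I1 := hprod iw hη' ρc
  have I2 : Integrable (fun z : ℝ × Torus n =>
      ε * ∑ i, D z.1 z.2 i * (η z.1 * -pderiv i ρ (x - z.2))) (cyl n T) :=
    (integrable_finsetSum _ fun i _ => hprod (iD i) hη.continuous (ρc' i)).const_mul ε
  have I3 := hprod ih hη.continuous ρc
  have I4 := hprod hw.integrable_f hη.continuous ρc
  rw [← sub_eq_zero, ← integral_sub ((I1.fun_add I2).fun_add I3) I4] at key
  have I5 : Integrable (fun z : ℝ × Torus n => w z.1 z.2 * (deriv η z.1 * ρ (x - z.2))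
      + ε * ∑ i, D z.1 z.2 i * (η z.1 * -pderiv i ρ (x - z.2))
      + h z.1 z.2 * (η z.1 * ρ (x - z.2)) - f z.1 z.2 * (η z.1 * ρ (x - z.2))) (cyl n T) :=
    ((I1.fun_add I2).fun_add I3).sub I4
  unfold cyl at key I5
  have key2 := integral_prod _ I5
  rw [key] at key2
  have sl : ∀ {q : ℝ → Torus n → ℝ}, Integrable (fun z : ℝ × Torus n => q z.1 z.2) (cyl n T) →
      ∀ᵐ t ∂(volume.restrict (Ioo 0 T)), Integrable (q t) := fun hq => hq.prod_right_ae
  have inner : ∀ᵐ t ∂(volume.restrict (Ioo 0 T)),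
      ∫ y, (w t y * (deriv η t * ρ (x - y)) + ε * ∑ i, D t y i * (η t * -pderiv i ρ (x - y)) +
        h t y * (η t * ρ (x - y)) - f t y * (η t * ρ (x - y))) =
      conv ρ (W t) x * deriv η t - (ε * conv (laplacian ρ) (w t) x
        - conv ρ (h t) x + conv ρ (f t) x) * η t := by
    filter_upwards [ae_restrict_mem measurableSet_Ioo, hw.isWeakGradient, sl iw, sl ih,
      sl hw.integrable_f, ae_all_iff.2 fun i => sl (q := fun t y => D t y i) (iD i)] with t ht hg jw jh jf jD
    have J1 := (integrable_conv_integrand hρ.continuous jw x).const_mul (deriv η t)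
    have J2 := fun i => (integrable_conv_integrand (hρ.pderiv i).continuous (jD i) x).const_mul
      (-η t)
    have J2' := (integrable_finsetSum Finset.univ fun i _ => J2 i).const_mul ε
    have J3 := (integrable_conv_integrand hρ.continuous jh x).const_mul (η t)
    have J4 := (integrable_conv_integrand hρ.continuous jf x).const_mul (η t)
    have e : ∀ y, (w t y * (deriv η t * ρ (x - y)) +
        ε * ∑ i, D t y i * (η t * -pderiv i ρ (x - y)) +
        h t y * (η t * ρ (x - y)) - f t y * (η t * ρ (x - y))) =
        deriv η t * (ρ (x - y) * w t y) +
        ε * ∑ i, -η t * (pderiv i ρ (x - y) * D t y i) + η t * (ρ (x - y) * h t y) -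
        η t * (ρ (x - y) * f t y) := by
      intro y
      have : ∀ i, D t y i * (η t * -pderiv i ρ (x - y)) =
        -η t * (pderiv i ρ (x - y) * D t y i) := fun i => by ring
      simp only [this]
      ring
    simp only [e]
    rw [integral_sub ((J1.fun_add J2').fun_add J3) J4, integral_add (J1.fun_add J2') J3, integral_add J1 J2', integral_const_mul, integral_const_mul, integral_const_mul,
      integral_const_mul, integral_finsetSum _ fun i _ => J2 i]
    simp only [integral_const_mul]
    have hlap : ∑ i, ∫ y, pderiv i ρ (x - y) * D t y i = conv (laplacian ρ) (w t) x := by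
      rw [conv_laplacian hρ jw]
      exact Finset.sum_congr rfl fun i _ => (hg.conv_pderiv (hρ.pderiv i) i x).symm
    rw [← Finset.mul_sum, hlap, hw.conv_eq ⟨ht.1.le, ht.2.le⟩]
    unfold conv
    ring
  rw [integral_congr_ae inner] at key2
  have hb1 : ∀ {g : ℝ → ℝ}, Continuous g → ∃ C, ∀ᵐ t ∂(volume.restrict (Ioo 0 T)), ‖g t‖ ≤ C := by
    intro g hg
    obtain ⟨C, hC⟩ := isCompact_Icc.exists_bound_of_continuousOn (s := Icc 0 T) hg.continuousOn
    refine ⟨C, ?_⟩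
    filter_upwards [ae_restrict_mem measurableSet_Ioo] with t ht
    exact hC t ⟨ht.1.le, ht.2.le⟩
  obtain ⟨C, hC⟩ := hb1 hη.continuous
  rw [integral_sub ?_ (hint.mul_bdd hη.continuous.aestronglyMeasurable hC)] at key2
  · linarith
  · exact ((hVc.mul hη').integrableOn_Icc (a := 0) (b := T)).mono_set Ioo_subset_Icc_self

end IsLinearSolution

/-! ### The comparison estimate -/

theorem enorm_rpow_two (a : ℝ) : ‖a‖ₑ ^ (2 : ℝ) = ENNReal.ofReal (a ^ 2) := by
  rw [← ofReal_norm, ENNReal.ofReal_rpow_of_nonneg (norm_nonneg _) (by norm_num),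
    Real.rpow_two, Real.norm_eq_abs, sq_abs]

theorem tendsto_integral_sq_conv_sub {T : ℝ} {h : ℝ → Torus n → ℝ}
    (hh : MemLp (fun z : ℝ × Torus n => h z.1 z.2) 2 (cyl n T)) :
    (∀ᶠ m in atTop, Integrable
      (fun z : ℝ × Torus n => (conv (mollifier m) (h z.1) z.2 - h z.1 z.2) ^ 2) (cyl n T)) ∧
    Tendsto (fun m => ∫ z, (conv (mollifier m) (h z.1) z.2 - h z.1 z.2) ^ 2 ∂(cyl n T))
      atTop (𝓝 0) := by
  have h1 := tendsto_lintegral_conv_mollifier_sub hh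
  simp only [enorm_rpow_two] at h1
  have hm : ∀ m : ℕ, AEStronglyMeasurable (fun z : ℝ × Torus n =>
      (conv (mollifier m) (h z.1) z.2 - h z.1 z.2) ^ 2) (cyl n T) := fun m =>
    ((integrable_conv_prod (isSmooth_mollifier m).continuous
      (hh.integrable one_le_two)).1.sub hh.1).pow 2
  refine ⟨?_, ?_⟩
  · filter_upwards [h1.eventually_lt_const (ENNReal.zero_lt_top)] with m hlt
    refine ⟨hm m, ?_⟩
    rw [hasFiniteIntegral_iff_ofReal (Eventually.of_forall fun z => sq_nonneg _)]
    exact hlt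
  · have h2 := (ENNReal.tendsto_toReal ENNReal.zero_ne_top).comp h1
    rw [ENNReal.toReal_zero] at h2
    refine h2.congr fun m => ?_
    rw [integral_eq_lintegral_of_nonneg_ae (Eventually.of_forall fun z => sq_nonneg _) (hm m)]
    rfl

theorem exists_ae_bound_cyl (T : ℝ) {g : ℝ × Torus n → ℝ} (hg : Continuous g) :
    ∃ C, ∀ᵐ z ∂(cyl n T), ‖g z‖ ≤ C := by
  obtain ⟨C, hC⟩ := (isCompact_Icc.prod isCompact_univ).exists_bound_of_continuousOn
    (s := Icc (0 : ℝ) T ×ˢ (univ : Set (Torus n))) hg.continuousOn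
  refine ⟨C, ?_⟩
  have h1 : ∀ᵐ z ∂(cyl n T), z.1 ∈ Ioo 0 T :=
    Measure.quasiMeasurePreserving_fst.ae (ae_restrict_mem measurableSet_Ioo)
  filter_upwards [h1] with z hz
  exact hC z ⟨⟨hz.1.le, hz.2.le⟩, mem_univ _⟩

theorem integrable_cyl_of_continuous (T : ℝ) {g : ℝ × Torus n → ℝ} (hg : Continuous g) :
    Integrable g (cyl n T) := by
  obtain ⟨C, hC⟩ := exists_ae_bound_cyl T hg
  exact Integrable.of_bound hg.aestronglyMeasurable C hC

/-- The bound `|h| ≤ M|D|` does not pass to mollifications, since `|ρ ∗ h|` is controlled by `ρ ∗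
|D|` and not by `|ρ ∗ D|`. With `c = ρ ∗ h` and `G = ρ ∗ D`, it is therefore used before mollifying,
at the price of two errors. -/
theorem neg_le_add_mul_norm {c h M : ℝ} {D G : Vec n} (hM : 0 ≤ M) (hh : |h| ≤ M * ‖D‖) :
    -c ≤ (|c - h| + M * ‖D - G‖) + M * ‖G‖ := by
  have h1 : -c ≤ |c - h| + |h| := by
    have := neg_abs_le (c - h)
    have := neg_abs_le h
    linarith
  have h2 : M * ‖D‖ ≤ M * (‖D - G‖ + ‖G‖) :=
    mul_le_mul_of_nonneg_left (by simpa using norm_add_le (D - G) G) hM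
  linarith

/-- The mollification error of the lower order terms. -/
def mollError (M : ℝ) (ρ : Torus n → ℝ) (h : ℝ → Torus n → ℝ) (D : ℝ → Torus n → Vec n)
    (z : ℝ × Torus n) : ℝ :=
  2 * (conv ρ (h z.1) z.2 - h z.1 z.2) ^ 2 +
    2 * M ^ 2 * ∑ i, (conv ρ (fun y => D z.1 y i) z.2 - D z.1 z.2 i) ^ 2

theorem mollError_nonneg (M : ℝ) (ρ : Torus n → ℝ) (h : ℝ → Torus n → ℝ)
    (D : ℝ → Torus n → Vec n) (z : ℝ × Torus n) : 0 ≤ mollError M ρ h D z := by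
  unfold mollError
  positivity

theorem continuous_integral_lower {F : ℝ → ℝ} (hF : Integrable F) (T : ℝ) :
    Continuous fun s => ∫ r in s..T, F r := by
  have e : (fun s => ∫ r in s..T, F r) = fun s => -∫ r in T..s, F r :=
    funext fun s => intervalIntegral.integral_symm _ _
  rw [e]
  exact (intervalIntegral.continuous_primitive (fun _ _ => hF.intervalIntegrable) T).neg

/-- The Fubini bookkeeping that leads to Grönwall: `P` is the penalty, `J` its time integrand, `Z`
the diffusion term with zero spatial mean, and `q` the error. -/
theorem integral_slice_le {T s ε C : ℝ} {P J Z q : ℝ × Torus n → ℝ} (hJi : Integrable J (cyl n T))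
    (hZi : Integrable Z (cyl n T)) (hPi : Integrable P (cyl n T)) (hq : Integrable q (cyl n T))
    (hq0 : ∀ z, 0 ≤ q z) (hpt : ∀ᵐ z ∂(cyl n T), J z ≤ ε * Z z + C * P z + q z)
    (hZ0 : ∀ r, ∫ x, Z (r, x) = 0) (hs0 : 0 < s) (hsT : s ≤ T)
    (hPs : Integrable fun x => P (s, x))
    (hPJ : ∀ x, P (s, x) ≤ ∫ r in Ioo s T, J (r, x)) :
    ∫ x, P (s, x) ≤ (∫ z, q z ∂(cyl n T)) + C * ∫ r in s..T, ∫ x, P (r, x) := by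
  have hle : (volume.restrict (Ioo s T)).prod (volume : Measure (Torus n)) ≤ cyl n T :=
    Measure.prod_mono (Measure.restrict_mono (Ioo_subset_Ioo_left hs0.le) le_rfl) le_rfl
  have hRi := ((hZi.const_mul ε).fun_add (hPi.const_mul C)).fun_add hq
  calc ∫ x, P (s, x)
      ≤ ∫ x, ∫ r in Ioo s T, J (r, x) :=
        integral_mono hPs (hJi.mono_measure hle).integral_prod_right hPJ
    _ = ∫ z, J z ∂((volume.restrict (Ioo s T)).prod volume) :=
        (integral_prod_symm _ (hJi.mono_measure hle)).symm
    _ ≤ ∫ z, (ε * Z z + C * P z + q z) ∂((volume.restrict (Ioo s T)).prod volume) :=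
        integral_mono_ae (hJi.mono_measure hle) (hRi.mono_measure hle) (ae_mono hle hpt)
    _ = C * (∫ r in s..T, ∫ x, P (r, x)) +
          ∫ z, q z ∂((volume.restrict (Ioo s T)).prod volume) := by
        have hz0 : ∫ z, Z z ∂((volume.restrict (Ioo s T)).prod volume) = 0 := by
          rw [integral_prod _ (hZi.mono_measure hle)]
          exact integral_eq_zero_of_ae (Eventually.of_forall hZ0)
        have hZ' := (hZi.const_mul ε).mono_measure hle
        have hP' := (hPi.const_mul C).mono_measure hle
        rw [integral_add (hZ'.fun_add hP') (hq.mono_measure hle), integral_add hZ' hP',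
          integral_const_mul, integral_const_mul, hz0, mul_zero, zero_add,
          integral_prod _ (hPi.mono_measure hle), intervalIntegral.integral_of_le hsT,
          integral_Ioc_eq_integral_Ioo]
    _ ≤ (∫ z, q z ∂(cyl n T)) + C * ∫ r in s..T, ∫ x, P (r, x) := by
        rw [add_comm]
        gcongr
        exact Eventually.of_forall hq0

namespace IsLinearSolution

variable {ε T : ℝ} {w h f : ℝ → Torus n → ℝ} {D : ℝ → Torus n → Vec n}
  {W : ℝ → Lp ℝ 2 (volume : Measure (Torus n))}

theorem tendsto_integral_mollError (hw : IsLinearSolution ε T w h f D W) (M : ℝ) :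
    (∀ᶠ m in atTop, Integrable (mollError M (mollifier m) h D) (cyl n T)) ∧
    Tendsto (fun m => ∫ z, mollError M (mollifier m) h D z ∂(cyl n T)) atTop (𝓝 0) := by
  obtain ⟨a1, b1⟩ := tendsto_integral_sq_conv_sub hw.memLp_h
  have hD := fun i => tendsto_integral_sq_conv_sub (h := fun t y => D t y i)
    (hw.memLp_grad_apply i)
  have a2 := eventually_all.2 fun i => (hD i).1
  refine ⟨?_, ?_⟩
  · filter_upwards [a1, a2] with m h1 h2
    exact (h1.const_mul 2).add ((integrable_finsetSum _ fun i _ => h2 i).const_mul (2 * M ^ 2))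
  · have lim := (b1.const_mul 2).add
      ((tendsto_finsetSum Finset.univ fun i _ => (hD i).2).const_mul (2 * M ^ 2))
    simp only [mul_zero, Finset.sum_const_zero, add_zero] at lim
    refine lim.congr' ?_
    filter_upwards [a1, a2] with m h1 h2
    unfold mollError
    rw [integral_add (h1.const_mul 2)
      ((integrable_finsetSum _ fun i _ => h2 i).const_mul (2 * M ^ 2)), integral_const_mul,
      integral_const_mul, integral_finsetSum _ fun i _ => h2 i]

/-- The integrand is the divergence of `P'(ρ ∗ v - k) D(ρ ∗ v)`. -/
theorem integral_penalty_diffusion_eq_zero {ρ v : Torus n → ℝ} (hρ : IsSmooth ρ)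
    (hv : Integrable v) (k : ℝ) :
    ∫ x, ∑ i, (penalty'' (conv ρ v x - k) * conv (pderiv i ρ) v x * conv (pderiv i ρ) v x +
      penalty' (conv ρ v x - k) * conv (pderiv i (pderiv i ρ)) v x) = 0 := by
  have c0 := continuous_conv hρ.continuous hv
  have c1 := fun i => continuous_conv (hρ.pderiv i).continuous hv
  have c2 := fun i => continuous_conv ((hρ.pderiv i).pderiv i).continuous hv
  have c3 : Continuous fun x => penalty' (conv ρ v x - k) :=
    continuous_penalty'.comp (c0.sub continuous_const)
  have c4 : Continuous fun x => penalty'' (conv ρ v x - k) :=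
    continuous_penalty''.comp (c0.sub continuous_const)
  have c5 : ∀ i, Continuous fun x => penalty'' (conv ρ v x - k) * conv (pderiv i ρ) v x *
      conv (pderiv i ρ) v x + penalty' (conv ρ v x - k) * conv (pderiv i (pderiv i ρ)) v x :=
    fun i => ((c4.mul (c1 i)).mul (c1 i)).add (c3.mul (c2 i))
  rw [integral_finsetSum _ fun i _ => integrable_of_continuous (c5 i)]
  refine Finset.sum_eq_zero fun i _ => ?_
  have hs : HasPartial i (fun x => conv ρ v x - k) (conv (pderiv i ρ) v) := fun x =>
    (hρ.hasPartial_conv hv i x).sub_const k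
  exact ((hs.comp hasDerivAt_penalty').mul ((hρ.pderiv i).hasPartial_conv hv i)).integral_eq_zero
    (c3.mul (c1 i)) (c5 i)

/-- Subtracting `G + ∫ₛᵀ F` disposes of the data: averaging by `ρ` preserves upper bounds, so the
penalty vanishes at `T`, and the source contributes `P' (ρ ∗ f - F) ≤ 0`. Only diffusion and the
drift term `h` are left. -/
theorem penalty_le_integral (hw : IsLinearSolution ε T w h f D W) {F : ℝ → ℝ} {G : ℝ}
    (hF : Integrable F) (hfF : ∀ᵐ t ∂(volume.restrict (Ioo 0 T)), ∀ᵐ x, f t x ≤ F t)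
    (hT : 0 < T) (hterm : ∀ᵐ x, w T x ≤ G) {ρ : Torus n → ℝ} (hρ : IsSmooth ρ)
    (hρ0 : ∀ x, 0 ≤ ρ x) (hρ1 : ∫ x, ρ x = 1) {t : ℝ} (ht0 : 0 < t) (htT : t ≤ T)
    (x : Torus n) :
    penalty (conv ρ (W t) x - (G + ∫ r in t..T, F r)) ≤
      ∫ s in Ioo t T, penalty' (conv ρ (W s) x - (G + ∫ r in s..T, F r)) *
        (ε * conv (laplacian ρ) (W s) x - conv ρ (h s) x) := by
  set a : ℝ → ℝ := fun s => conv ρ (W s) x - (G + ∫ r in s..T, F r) with ha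
  have hFi : ∀ s s', IntervalIntegrable F volume s s' := fun s s' => hF.intervalIntegrable
  have hac : Continuous a := by
    refine ((continuous_conv_uncurry hρ.continuous hw.continuous).comp
      (continuous_id.prodMk continuous_const)).sub 
      (continuous_const.add (continuous_integral_lower hF T))
  have toI : ∀ {q : ℝ → ℝ}, IntegrableOn q (Ioo 0 T) → IntervalIntegrable q volume t T := by
    intro q hq
    rw [intervalIntegrable_iff_integrableOn_Ioo_of_le htT]
    exact hq.mono_set (Ioo_subset_Ioo_left ht0.le)
  have hα := hw.integrable_conv_rhs hρ x
  have hαt := toI hα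
  have hβ : IntervalIntegrable (fun s => (ε * conv (laplacian ρ) (w s) x
      - conv ρ (h s) x + conv ρ (f s) x) - F s) volume t T := hαt.sub (hFi t T)
  have haT : ∀ s ∈ Icc t T, a s = a T + ∫ r in s..T, ((ε * conv (laplacian ρ) (w r) x
      - conv ρ (h r) x + conv ρ (f r) x) - F r) := by
    intro s hs
    have h1 := hw.conv_eq_add_integral hρ x (ht0.trans_le hs.1) hs.2
    have hsub : uIcc s T ⊆ uIcc t T := by
      rw [uIcc_of_le hs.2, uIcc_of_le htT]
      exact Icc_subset_Icc_left hs.1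
    rw [intervalIntegral.integral_sub (hαt.mono_set hsub) (hFi s T)]
    simp only [ha, intervalIntegral.integral_same]
    linarith
  have hchain := comp_eq_add_integral htT hasDerivAt_penalty continuous_penalty' hβ haT
  have hTT : T ∈ Icc 0 T := ⟨hT.le, le_rfl⟩
  have haT0 : penalty (a T) = 0 := by
    rw [penalty_eq_zero_iff]
    simp only [ha, intervalIntegral.integral_same, add_zero, sub_nonpos]
    refine conv_le hρ.continuous hρ0 hρ1 (integrable_Lp _) ?_ x
    filter_upwards [hw.ae_eq T hTT, hterm] with y h1 h2
    rw [h1]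
    exact h2
  have hΦ : ContinuousOn (fun s => penalty' (a s)) (uIcc t T) :=
    (continuous_penalty'.comp hac).continuousOn
  have hL : IntervalIntegrable (fun s => ε * conv (laplacian ρ) (W s) x - conv ρ (h s) x)
      volume t T := by
    refine IntervalIntegrable.sub ?_ (toI (integrable_conv_left hρ.continuous
      (hw.memLp_h.integrable one_le_two) x))
    exact (continuous_const.mul ((continuous_conv_uncurry hρ.laplacian.continuous
      hw.continuous).comp (continuous_id.prodMk continuous_const))).intervalIntegrable _ _
  rw [hchain, haT0, zero_add, ← integral_Ioc_eq_integral_Ioo,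
    ← intervalIntegral.integral_of_le htT]
  refine intervalIntegral.integral_mono_ae_restrict htT (hβ.continuousOn_mul hΦ)
    (hL.continuousOn_mul hΦ) ?_
  rw [← restrict_Ioo_eq_restrict_Icc]
  have hmono : volume.restrict (Ioo t T) ≤ volume.restrict (Ioo 0 T) :=
    Measure.restrict_mono (Ioo_subset_Ioo_left ht0.le) le_rfl
  have hfi : ∀ᵐ s ∂(volume.restrict (Ioo 0 T)), Integrable (f s) := hw.integrable_f.prod_right_ae
  filter_upwards [ae_mono hmono hfF, ae_mono hmono hfi, ae_restrict_mem measurableSet_Ioo]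
    with s h1 h2 h3
  refine mul_le_mul_of_nonneg_left ?_ (penalty'_nonneg _)
  rw [← hw.conv_eq ⟨(ht0.trans h3.1).le, h3.2.le⟩]
  have := conv_le hρ.continuous hρ0 hρ1 h2 h1 x
  linarith

/-- Adding and subtracting `εP''|D(ρ ∗ w)|²` completes the Laplacian term to a divergence; the
negative copy absorbs the drift by `penalty'_mul_le`. -/
theorem integrand_le (hw : IsLinearSolution ε T w h f D W) (hε : 0 < ε) {M : ℝ} (hM : 0 ≤ M)
    (hhM : ∀ᵐ z ∂(cyl n T), |h z.1 z.2| ≤ M * ‖D z.1 z.2‖) {ρ : Torus n → ℝ} (hρ : IsSmooth ρ)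
    (k : ℝ → ℝ) : ∀ᵐ z ∂(cyl n T), penalty' (conv ρ (W z.1) z.2 - k z.1) *
      (ε * conv (laplacian ρ) (W z.1) z.2 - conv ρ (h z.1) z.2) ≤
      ε * (∑ i, (penalty'' (conv ρ (W z.1) z.2 - k z.1) *
        conv (pderiv i ρ) (W z.1) z.2 * conv (pderiv i ρ) (W z.1) z.2 +
        penalty' (conv ρ (W z.1) z.2 - k z.1) * conv (pderiv i (pderiv i ρ)) (W z.1) z.2)) +
      (1 + M ^ 2 / (2 * ε)) * penalty (conv ρ (W z.1) z.2 - k z.1) + mollError M ρ h D z := by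
  have t1 : ∀ᵐ z ∂(cyl n T), z.1 ∈ Ioo 0 T :=
    Measure.quasiMeasurePreserving_fst.ae (ae_restrict_mem measurableSet_Ioo)
  have t2 : ∀ᵐ z ∂(cyl n T), IsWeakGradient (w z.1) (D z.1) :=
    Measure.quasiMeasurePreserving_fst.ae hw.isWeakGradient
  filter_upwards [t1, t2, hhM] with z z1 z2 z3
  set b : ℝ := conv ρ (W z.1) z.2 - k z.1
  let Dv : Vec n := WithLp.toLp 2 fun i => conv ρ (fun y => D z.1 y i) z.2
  have e1 : ∀ i, conv (pderiv i ρ) (W z.1) z.2 = Dv i := fun i => by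
    rw [hw.conv_eq ⟨z1.1.le, z1.2.le⟩, z2.conv_pderiv hρ]
  have e2 : ‖Dv‖ ^ 2 = ∑ i, Dv i * Dv i := by
    rw [EuclideanSpace.real_norm_sq_eq]
    exact Finset.sum_congr rfl fun i _ => sq _
  have e3 : ‖D z.1 z.2 - Dv‖ ^ 2 =
      ∑ i, (conv ρ (fun y => D z.1 y i) z.2 - D z.1 z.2 i) ^ 2 := by
    rw [norm_sub_rev, EuclideanSpace.real_norm_sq_eq]
    rfl
  have i1 := mul_le_mul_of_nonneg_left
    (neg_le_add_mul_norm (c := conv ρ (h z.1) z.2) (G := Dv) hM z3) (penalty'_nonneg b)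
  have i2 := penalty'_mul_le hε M b
    (|conv ρ (h z.1) z.2 - h z.1 z.2| + M * ‖D z.1 z.2 - Dv‖) ‖Dv‖
  -- From `(x + y)² ≤ 2x² + 2y²`, the source of the factors `2` and `2M²` in `mollError`.
  have i3 : (|conv ρ (h z.1) z.2 - h z.1 z.2| + M * ‖D z.1 z.2 - Dv‖) ^ 2 ≤
      mollError M ρ h D z := by
    unfold mollError
    rw [← e3, ← sq_abs (conv ρ (h z.1) z.2 - h z.1 z.2)]
    nlinarith [sq_nonneg (|conv ρ (h z.1) z.2 - h z.1 z.2| - M * ‖D z.1 z.2 - Dv‖)]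
  have e4 : (∑ i, (penalty'' b * conv (pderiv i ρ) (W z.1) z.2 * conv (pderiv i ρ) (W z.1) z.2 +
        penalty' b * conv (pderiv i (pderiv i ρ)) (W z.1) z.2)) = penalty'' b * ‖Dv‖ ^ 2 + penalty' b * conv (laplacian ρ) (W z.1) z.2 := by
    rw [conv_laplacian hρ (integrable_Lp _), e2, Finset.mul_sum, Finset.mul_sum,
      ← Finset.sum_add_distrib]
    refine Finset.sum_congr rfl fun i _ => ?_
    rw [e1]
    ring
  have e5 : penalty' b * (ε * conv (laplacian ρ) (W z.1) z.2 - conv ρ (h z.1) z.2) = ε * (penalty' b * conv (laplacian ρ) (W z.1) z.2) +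
      penalty' b * -conv ρ (h z.1) z.2 := by
    ring
  rw [e4, e5]
  linarith

/-- The exponential factor does not depend on the kernel, so the right side vanishes with the
mollification error. -/
theorem energy_le (hw : IsLinearSolution ε T w h f D W) (hε : 0 < ε) {M : ℝ} (hM : 0 ≤ M)
    (hhM : ∀ᵐ z ∂(cyl n T), |h z.1 z.2| ≤ M * ‖D z.1 z.2‖) {F : ℝ → ℝ} {G : ℝ}
    (hF : Integrable F) (hfF : ∀ᵐ t ∂(volume.restrict (Ioo 0 T)), ∀ᵐ x, f t x ≤ F t)
    (hT : 0 < T) (hterm : ∀ᵐ x, w T x ≤ G) {ρ : Torus n → ℝ} (hρ : IsSmooth ρ)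
    (hρ0 : ∀ x, 0 ≤ ρ x) (hρ1 : ∫ x, ρ x = 1)
    (hq : Integrable (mollError M ρ h D) (cyl n T)) {t : ℝ} (ht0 : 0 < t) (htT : t ≤ T) :
    ∫ x, penalty (conv ρ (W t) x - (G + ∫ r in t..T, F r)) ≤
      (∫ z, mollError M ρ h D z ∂(cyl n T)) * Real.exp ((1 + M ^ 2 / (2 * ε)) * (T - t)) := by
  set k : ℝ → ℝ := fun s => G + ∫ r in s..T, F r with hk
  have hkc : Continuous k := continuous_const.add (continuous_integral_lower hF T)
  have hac : Continuous fun z : ℝ × Torus n => conv ρ (W z.1) z.2 - k z.1 :=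
    (continuous_conv_uncurry hρ.continuous hw.continuous).sub (hkc.comp continuous_fst)
  have hPc : Continuous fun z : ℝ × Torus n => penalty (conv ρ (W z.1) z.2 - k z.1) :=
    continuous_penalty.comp hac
  have hP'c : Continuous fun z : ℝ × Torus n => penalty' (conv ρ (W z.1) z.2 - k z.1) :=
    continuous_penalty'.comp hac
  have hE : Continuous fun s => ∫ x, penalty (conv ρ (W s) x - k s) := by
    have := continuous_parametric_integral_of_continuous (μ := (volume : Measure (Torus n)))
      (f := fun s x => penalty (conv ρ (W s) x - k s)) hPc isCompact_univ
    simpa only [setIntegral_univ] using this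
  refine le_mul_exp_of_le_add_integral htT hE (by positivity) fun s hs => ?_
  have hs0 : 0 < s := ht0.trans_le hs.1
  set J : ℝ × Torus n → ℝ := fun z => penalty' (conv ρ (W z.1) z.2 - k z.1) *
    (ε * conv (laplacian ρ) (W z.1) z.2 - conv ρ (h z.1) z.2) with hJ
  set Z : ℝ × Torus n → ℝ := fun z => ∑ i, (penalty'' (conv ρ (W z.1) z.2 - k z.1) *
    conv (pderiv i ρ) (W z.1) z.2 * conv (pderiv i ρ) (W z.1) z.2 +
    penalty' (conv ρ (W z.1) z.2 - k z.1) * conv (pderiv i (pderiv i ρ)) (W z.1) z.2) with hZ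
  have hZc : Continuous Z := by
    refine continuous_finsetSum _ fun i _ => ?_
    have c1 := continuous_conv_uncurry (hρ.pderiv i).continuous hw.continuous
    have c2 := continuous_conv_uncurry ((hρ.pderiv i).pderiv i).continuous hw.continuous
    exact (((continuous_penalty''.comp hac).mul c1).mul c1).add (hP'c.mul c2)
  have hJi : Integrable J (cyl n T) := by
    obtain ⟨C, hC⟩ := exists_ae_bound_cyl T hP'c
    refine Integrable.bdd_mul (c := C) (Integrable.sub ?_ ?_) hP'c.aestronglyMeasurable hC
    · exact integrable_cyl_of_continuous T (continuous_const.mul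
        (continuous_conv_uncurry hρ.laplacian.continuous hw.continuous))
    · exact integrable_conv_prod hρ.continuous (hw.memLp_h.integrable one_le_two)
  have hZi := integrable_cyl_of_continuous T hZc
  have hPi := integrable_cyl_of_continuous T hPc
  exact integral_slice_le (s := s) hJi hZi hPi hq (mollError_nonneg M ρ h D)
    (hw.integrand_le hε hM hhM hρ k)
    (fun r => integral_penalty_diffusion_eq_zero hρ (integrable_Lp (W r)) (k r)) hs0 hs.2
    (integrable_of_continuous (hPc.comp (continuous_const.prodMk continuous_id)))
    (hw.penalty_le_integral hF hfF hT hterm hρ hρ0 hρ1 hs0 hs.2)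

/-- As the mollifier is removed, the penalty integrals tend to zero. Convergence in `L²` gives
almost everywhere convergence along a subsequence, Fatou yields `∫ P(w - κ) = 0`, and the penalty
vanishes only at nonpositive arguments. -/
theorem ae_le (hw : IsLinearSolution ε T w h f D W) (hε : 0 < ε) {M : ℝ} (hM : 0 ≤ M)
    (hhM : ∀ᵐ z ∂(cyl n T), |h z.1 z.2| ≤ M * ‖D z.1 z.2‖) {F : ℝ → ℝ} {G : ℝ}
    (hF : Integrable F) (hfF : ∀ᵐ t ∂(volume.restrict (Ioo 0 T)), ∀ᵐ x, f t x ≤ F t)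
    (hterm : ∀ᵐ x, w T x ≤ G) {t : ℝ} (ht : t ∈ Ioo 0 T) :
    ∀ᵐ x, w t x ≤ G + ∫ r in t..T, F r := by
  have hT : 0 < T := ht.1.trans ht.2
  set κ := G + ∫ r in t..T, F r with hκ
  obtain ⟨hqi, hq0⟩ := hw.tendsto_integral_mollError M
  have hL2 := Lp.memLp (W t)
  have hconv := tendsto_eLpNorm_conv_mollifier one_le_two ENNReal.ofNat_ne_top hL2
  have cont : ∀ m : ℕ, Continuous (conv (mollifier m) (W t)) := fun m =>
    continuous_conv (isSmooth_mollifier m).continuous (integrable_Lp _)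
  have hmeas : TendstoInMeasure volume (fun m => conv (mollifier m) (W t)) atTop (W t) :=
    tendstoInMeasure_of_tendsto_eLpNorm two_ne_zero
      (fun m => (cont m).aestronglyMeasurable) hL2.1 hconv
  obtain ⟨ns, hns, hae⟩ := hmeas.exists_seq_tendsto_ae
  set B := Real.exp ((1 + M ^ 2 / (2 * ε)) * (T - t))
  have hbound : ∀ᶠ m in atTop, ∫⁻ x, ENNReal.ofReal (penalty (conv (mollifier m) (W t) x - κ)) ≤
      ENNReal.ofReal ((∫ z, mollError M (mollifier m) h D z ∂(cyl n T)) * B) := by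
    filter_upwards [hqi] with m hm
    have hi : Integrable fun x => penalty (conv (mollifier m) (W t) x - κ) :=
      integrable_of_continuous (continuous_penalty.comp ((cont m).sub continuous_const))
    rw [← ofReal_integral_eq_lintegral_ofReal hi
      (Eventually.of_forall fun x => penalty_nonneg _)]
    exact ENNReal.ofReal_le_ofReal (hw.energy_le hε hM hhM hF hfF hT hterm (isSmooth_mollifier m)
      (mollifier_nonneg m) (integral_mollifier m) hm ht.1 ht.2.le)
  have hlim : Tendsto (fun m => ∫⁻ x, ENNReal.ofReal (penalty (conv (mollifier m) (W t) x - κ)))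
      atTop (𝓝 0) := by
    have h1 := ENNReal.tendsto_ofReal (hq0.mul_const B)
    rw [zero_mul, ENNReal.ofReal_zero] at h1
    exact tendsto_of_tendsto_of_tendsto_of_le_of_le' tendsto_const_nhds h1
      (Eventually.of_forall fun _ => zero_le) hbound
  have hfatou : ∫⁻ x, ENNReal.ofReal (penalty (W t x - κ)) ≤ 0 := by
    calc ∫⁻ x, ENNReal.ofReal (penalty (W t x - κ))
        ≤ ∫⁻ x, liminf (fun j => ENNReal.ofReal
            (penalty (conv (mollifier (ns j)) (W t) x - κ))) atTop := by
          refine lintegral_mono_ae (hae.mono fun x hx => le_of_eq ?_)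
          refine (Tendsto.liminf_eq ?_).symm
          exact ((ENNReal.continuous_ofReal.comp continuous_penalty).tendsto _).comp
            (hx.sub_const κ)
      _ ≤ liminf (fun j => ∫⁻ x, ENNReal.ofReal
            (penalty (conv (mollifier (ns j)) (W t) x - κ))) atTop := by
          refine lintegral_liminf_le' fun j => ?_
          exact (ENNReal.continuous_ofReal.comp (continuous_penalty.comp
            ((cont (ns j)).sub continuous_const))).measurable.aemeasurable
      _ = 0 := (hlim.comp hns.tendsto_atTop).liminf_eq
  have hm : AEMeasurable (fun x => ENNReal.ofReal (penalty (W t x - κ))) volume :=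
    (ENNReal.continuous_ofReal.comp continuous_penalty).measurable.comp_aemeasurable
      (hL2.1.aemeasurable.sub_const κ)
  have hzero := (lintegral_eq_zero_iff' hm).1 (le_antisymm hfatou zero_le)
  filter_upwards [hzero, hw.ae_eq t ⟨ht.1.le, ht.2.le⟩] with x hx hx'
  have h1 := penalty_eq_zero_iff.1
    (le_antisymm (ENNReal.ofReal_eq_zero.1 hx) (penalty_nonneg _))
  rw [hx'] at h1
  linarith

end IsLinearSolution

/-! ### Interpolation between `L^∞` and the Laplacian in `L¹` -/

theorem sum_integral_sq_eq {v : Torus n → ℝ} {v' v'' : Fin n → Torus n → ℝ} (hv : Continuous v)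
    (hv' : ∀ i, Continuous (v' i)) (hv'' : ∀ i, Continuous (v'' i))
    (h : ∀ i, HasPartial i v (v' i)) (h' : ∀ i, HasPartial i (v' i) (v'' i)) :
    ∑ i, ∫ x, v' i x ^ 2 = -∫ x, v x * ∑ i, v'' i x := by
  have h1 : ∀ i, ∫ x, v' i x ^ 2 = -∫ x, v x * v'' i x := fun i => by
    rw [(h i).integral_mul (h' i) hv (hv' i) (hv' i) (hv'' i), neg_neg]
    simp only [sq]
  have h2 : ∀ i, Integrable fun x => v x * v'' i x := fun i =>
    integrable_of_continuous (hv.mul (hv'' i))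
  simp only [h1, Finset.mul_sum]
  rw [integral_finsetSum _ fun i _ => h2 i,
    Finset.sum_neg_distrib]

theorem neg_integral_mul_le {v q : Torus n → ℝ} {C : ℝ} (hv : Continuous v) (hq : Continuous q)
    (hC : ∀ x, |v x| ≤ C) : -∫ x, v x * q x ≤ C * ∫ x, |q x| := by
  rw [← integral_neg, ← integral_const_mul]
  refine integral_mono (integrable_of_continuous (hv.mul hq).neg)
    (integrable_of_continuous (continuous_const.mul hq.abs)) fun x => ?_
  calc -(v x * q x) ≤ |v x| * |q x| := by rw [← abs_mul]; exact neg_le_abs _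
    _ ≤ C * |q x| := mul_le_mul_of_nonneg_right (hC x) (abs_nonneg _)

theorem integral_abs_eq_toReal {v : Torus n → ℝ} (hv : AEStronglyMeasurable v) :
    ∫ x, |v x| = (eLpNorm v 1 volume).toReal := by
  rw [eLpNorm_one_eq_lintegral_enorm]
  exact integral_norm_eq_lintegral_enorm hv

theorem eLpNorm_two_sq {X E : Type*} [MeasurableSpace X] [NormedAddCommGroup E] {μ : Measure X}
    (f : X → E) : eLpNorm f 2 μ ^ 2 = ∫⁻ x, ‖f x‖ₑ ^ 2 ∂μ := by
  rw [← ENNReal.rpow_two, eLpNorm_eq_lintegral_rpow_enorm_toReal two_ne_zero ENNReal.ofNat_ne_top,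
    ← ENNReal.rpow_mul]
  simp

/-- The gradient of the mollification of a function. -/
def mollGrad (m : ℕ) (u : Torus n → ℝ) (x : Torus n) : Vec n :=
  WithLp.toLp 2 fun i => conv (pderiv i (mollifier m)) u x

theorem continuous_mollGrad (m : ℕ) {u : Torus n → ℝ} (hu : Integrable u) :
    Continuous (mollGrad m u) :=
  (PiLp.continuous_toLp 2 _).comp (continuous_pi fun i =>
    continuous_conv ((isSmooth_mollifier m).pderiv i).continuous hu)

theorem memLp_of_continuous {E : Type*} [NormedAddCommGroup E] {f : Torus n → E}
    (hf : Continuous f) [SecondCountableTopology E] (p : ℝ≥0∞) : MemLp f p volume := by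
  obtain ⟨C, hC⟩ := isCompact_univ.exists_bound_of_continuousOn hf.continuousOn
  exact MemLp.of_bound hf.aestronglyMeasurable C (Eventually.of_forall fun x => hC x (mem_univ _))

theorem norm_toLp_sq {f : Torus n → Vec n} (hf : Continuous f) :
    ‖(memLp_of_continuous hf 2).toLp f‖ ^ 2 = ∑ i, ∫ x, f x i ^ 2 := by
  have hi : ∀ i, Continuous fun x => f x i := fun i =>
    (EuclideanSpace.proj (𝕜 := ℝ) i).continuous.comp hf
  have hi2 : ∀ i, Integrable fun x => f x i ^ 2 := fun i =>
    integrable_of_continuous ((hi i).pow 2)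
  rw [← integral_finsetSum _ fun i _ => hi2 i, Lp.norm_toLp,
    ← ENNReal.toReal_pow, eLpNorm_two_sq]
  have e : ∀ x, ‖f x‖ₑ ^ 2 = ENNReal.ofReal (∑ i, f x i ^ 2) := fun x => by
    rw [← EuclideanSpace.real_norm_sq_eq, ENNReal.ofReal_pow (norm_nonneg _), ofReal_norm]
  simp only [e]
  rw [integral_eq_lintegral_of_nonneg_ae
    (Eventually.of_forall fun x => Finset.sum_nonneg fun i _ => sq_nonneg _)
    (continuous_finsetSum _ fun i _ => (hi i).pow 2).aestronglyMeasurable]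

theorem tendsto_integral_mul_of_tendsto_eLpNorm {f : ℕ → Torus n → ℝ} {g ψ : Torus n → ℝ}
    (hf : ∀ m, Integrable (f m)) (hg : Integrable g) (hψ : Continuous ψ)
    (h : Tendsto (fun m => eLpNorm (fun x => f m x - g x) 1 volume) atTop (𝓝 0)) :
    Tendsto (fun m => ∫ x, f m x * ψ x) atTop (𝓝 (∫ x, g x * ψ x)) := by
  obtain ⟨C, hC0, hC⟩ := exists_bound_of_continuous hψ
  have hb : ∀ {q : Torus n → ℝ}, Integrable q → Integrable fun x => q x * ψ x := fun hq =>
    hq.mul_bdd hψ.aestronglyMeasurable (Eventually.of_forall hC)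
  refine tendsto_integral_of_L1' _ (hb hg).1 (Eventually.of_forall fun m => hb (hf m)) ?_
  have h1 := ENNReal.Tendsto.const_mul (a := ENNReal.ofReal C) h (Or.inr ENNReal.ofReal_ne_top)
  rw [mul_zero] at h1
  refine tendsto_of_tendsto_of_tendsto_of_le_of_le tendsto_const_nhds h1
    (fun _ => zero_le) fun m => ?_
  refine eLpNorm_le_mul_eLpNorm_of_ae_le_mul (Eventually.of_forall fun x => ?_) 1
  simp only [Pi.sub_apply]
  rw [← sub_mul, norm_mul, mul_comm]
  exact mul_le_mul_of_nonneg_right (hC x) (norm_nonneg _)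

section Interpolation

variable {u L : Torus n → ℝ} {K : ℝ}

/-- Integration by parts for the mollified function: mollification increases neither the sup bound
`K` nor the `L¹` norm of the Laplacian. -/
theorem norm_sq_mollGrad_le (hu : Integrable u) (hL : Integrable L) (hK : ∀ᵐ x, |u x| ≤ K)
    (hlap : ∀ m x, conv (laplacian (mollifier m)) u x = conv (mollifier m) L x) (m : ℕ) :
    ‖(memLp_of_continuous (continuous_mollGrad m hu) 2).toLp (mollGrad m u)‖ ^ 2 ≤
      K * ∫ x, |L x| := by
  have hs := isSmooth_mollifier (n := n) m
  have hKm : ∀ x, |conv (mollifier m) u x| ≤ K :=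
    abs_conv_le_of_abs_le hs.continuous (mollifier_nonneg m) (integral_mollifier m) hu hK
  have hK0 : 0 ≤ K := (abs_nonneg _).trans (hKm 0)
  rw [norm_toLp_sq (continuous_mollGrad m hu)]
  simp only [mollGrad]
  rw [sum_integral_sq_eq (continuous_conv hs.continuous hu)
    (fun i => continuous_conv (hs.pderiv i).continuous hu)
    (fun i => continuous_conv ((hs.pderiv i).pderiv i).continuous hu)
    (fun i => hs.hasPartial_conv hu i) (fun i => (hs.pderiv i).hasPartial_conv hu i)]
  simp only [← conv_laplacian hs hu, hlap]
  refine (neg_integral_mul_le (continuous_conv hs.continuous hu)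
    (continuous_conv hs.continuous hL) hKm).trans (mul_le_mul_of_nonneg_left ?_ hK0)
  rw [integral_abs_eq_toReal (continuous_conv hs.continuous hL).aestronglyMeasurable,
    integral_abs_eq_toReal hL.1]
  exact ENNReal.toReal_mono (memLp_one_iff_integrable.2 hL).2.ne
    (eLpNorm_conv_le hs.continuous (mollifier_nonneg m) (integral_mollifier m) le_rfl
      ENNReal.one_ne_top hL.1)

/-- The same identity for the difference of two mollifications, which is bounded by `2K`; its
Laplacian is split through `L`. -/
theorem norm_sq_mollGrad_sub_le (hu : Integrable u) (hL : Integrable L)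
    (hK : ∀ᵐ x, |u x| ≤ K)
    (hlap : ∀ m x, conv (laplacian (mollifier m)) u x = conv (mollifier m) L x) (m m' : ℕ) :
    ‖(memLp_of_continuous (continuous_mollGrad m hu) 2).toLp (mollGrad m u) -
      (memLp_of_continuous (continuous_mollGrad m' hu) 2).toLp (mollGrad m' u)‖ ^ 2 ≤
      (2 * K) * ((∫ x, |conv (mollifier m) L x - L x|) +
        ∫ x, |conv (mollifier m') L x - L x|) := by
  have hs := isSmooth_mollifier (n := n)
  have hKm : ∀ m x, |conv (mollifier m) u x| ≤ K := fun m =>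
    abs_conv_le_of_abs_le (hs m).continuous (mollifier_nonneg m) (integral_mollifier m) hu hK
  have hK0 : 0 ≤ K := (abs_nonneg _).trans (hKm 0 0)
  have c0 := fun m => continuous_conv (hs m).continuous hu
  have c1 := fun m i => continuous_conv ((hs m).pderiv i).continuous hu
  have c2 := fun m i => continuous_conv (((hs m).pderiv i).pderiv i).continuous hu
  have cL := fun m => continuous_conv (hs m).continuous hL
  rw [← MemLp.toLp_sub]
  have h1 := norm_toLp_sq ((continuous_mollGrad m hu).sub (continuous_mollGrad m' hu))
  refine (le_of_eq h1).trans ?_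
  simp only [mollGrad, PiLp.sub_apply, Pi.sub_apply]
  rw [sum_integral_sq_eq (v := fun x => conv (mollifier m) u x - conv (mollifier m') u x)
    (v' := fun i x => conv (pderiv i (mollifier m)) u x - conv (pderiv i (mollifier m')) u x)
    (v'' := fun i x => conv (pderiv i (pderiv i (mollifier m))) u x -
      conv (pderiv i (pderiv i (mollifier m'))) u x) ((c0 m).sub (c0 m')) (fun i => (c1 m i).sub (c1 m' i))
    (fun i => (c2 m i).sub (c2 m' i))
    (fun i => ((hs m).hasPartial_conv hu i).sub ((hs m').hasPartial_conv hu i))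
    (fun i => (((hs m).pderiv i).hasPartial_conv hu i).sub
      (((hs m').pderiv i).hasPartial_conv hu i))]
  simp only [Finset.sum_sub_distrib, ← conv_laplacian (hs _) hu, hlap]
  refine (neg_integral_mul_le ((c0 m).sub (c0 m')) ((cL m).sub (cL m')) (C := 2 * K)
    fun x => ?_).trans (mul_le_mul_of_nonneg_left ?_ (by positivity))
  · have := hKm m x
    have := hKm m' x
    have := abs_sub (conv (mollifier m) u x) (conv (mollifier m') u x)
    rw [Pi.sub_apply]
    linarith
  · have i1 : ∀ m, Integrable fun x => |conv (mollifier m) L x - L x| := fun m =>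
      ((integrable_of_continuous (cL m)).sub hL).abs
    rw [← integral_add (i1 m) (i1 m')]
    refine integral_mono (integrable_of_continuous ((cL m).sub (cL m')).abs)
      ((i1 m).add (i1 m')) fun x => ?_
    have := abs_sub (conv (mollifier m) L x - L x) (conv (mollifier m') L x - L x)
    rwa [sub_sub_sub_cancel_right] at this

/-- The mollified gradients are Cauchy, so they converge strongly in `L²`. The limit inherits
integration by parts, hence is a weak gradient, and inherits the norm bound. Only the commutation
`hlap` with the mollifiers is required, so the fixed-time and cylinder cases share the argument. -/
theorem exists_isWeakGradient_of_bounded (hu : Integrable u) (hL : Integrable L)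
    (hK : ∀ᵐ x, |u x| ≤ K)
    (hlap : ∀ m x, conv (laplacian (mollifier m)) u x = conv (mollifier m) L x) :
    ∃ G : Torus n → Vec n, IsWeakGradient u G ∧
      eLpNorm G 2 volume ^ 2 ≤ eLpNorm L 1 volume * ENNReal.ofReal K := by
  have hs := isSmooth_mollifier (n := n)
  have hK0 : 0 ≤ K := by
    obtain ⟨x, hx⟩ := hK.exists
    exact (abs_nonneg _).trans hx
  let S : ℕ → Lp (Vec n) 2 (volume : Measure (Torus n)) := fun m =>
    (memLp_of_continuous (continuous_mollGrad m hu) 2).toLp (mollGrad m u)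
  have tL1 : ∀ {v : Torus n → ℝ}, Integrable v →
      Tendsto (fun m => eLpNorm (fun x => conv (mollifier m) v x - v x) 1 volume) atTop (𝓝 0) :=
    fun hv => tendsto_eLpNorm_conv_mollifier le_rfl ENNReal.one_ne_top
      (memLp_one_iff_integrable.2 hv)
  have he : Tendsto (fun m => ∫ x, |conv (mollifier m) L x - L x|) atTop (𝓝 0) := by
    have h1 := (ENNReal.tendsto_toReal ENNReal.zero_ne_top).comp (tL1 hL)
    rw [ENNReal.toReal_zero] at h1
    exact h1.congr fun m => (integral_abs_eq_toReal
      ((continuous_conv (hs m).continuous hL).aestronglyMeasurable.sub hL.1)).symm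
  have hcau : CauchySeq S := by
    rw [Metric.cauchySeq_iff]
    intro δ hδ
    -- Two such errors times `2K` total `δ² K/(K+1) < δ²`; the `+ 1` covers `K = 0`.
    have h1 : ∀ᶠ m in atTop, ∫ x, |conv (mollifier m) L x - L x| < δ ^ 2 / (4 * (K + 1)) :=
      he.eventually_lt_const (by positivity)
    obtain ⟨N, hN⟩ := eventually_atTop.1 h1
    refine ⟨N, fun m hm m' hm' => ?_⟩
    rw [dist_eq_norm]
    refine lt_of_pow_lt_pow_left₀ 2 hδ.le ?_
    refine (norm_sq_mollGrad_sub_le hu hL hK hlap m m').trans_lt ?_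
    have a1 := hN m hm
    have a2 := hN m' hm'
    calc (2 * K) * ((∫ x, |conv (mollifier m) L x - L x|) +
          ∫ x, |conv (mollifier m') L x - L x|)
        ≤ (2 * K) * (δ ^ 2 / (4 * (K + 1)) + δ ^ 2 / (4 * (K + 1))) := by gcongr
      _ = δ ^ 2 * (K / (K + 1)) := by field_simp; ring
      _ < δ ^ 2 * 1 := by
          refine mul_lt_mul_of_pos_left ?_ (by positivity)
          rw [div_lt_one (by positivity)]
          linarith
      _ = δ ^ 2 := mul_one _
  obtain ⟨G, hG⟩ := cauchySeq_tendsto_of_complete hcau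
  refine ⟨G, ⟨hu, (Lp.memLp G).integrable one_le_two, fun φ hφ i => ?_⟩, ?_⟩
  · have hGi : Integrable fun x => G x i :=
      ((Lp.memLp G).continuousLinearMap_comp
        (EuclideanSpace.proj (𝕜 := ℝ) i)).integrable one_le_two
    have c1 := fun m => continuous_conv ((hs m).pderiv i).continuous hu
    have l1 := tendsto_integral_mul_of_tendsto_eLpNorm
      (fun m => integrable_of_continuous (continuous_conv (hs m).continuous hu)) hu
      (hφ.pderiv i).continuous (tL1 hu)
    have hconv : Tendsto (fun m => eLpNorm (fun x => conv (pderiv i (mollifier m)) u x - G x i) 1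
        volume) atTop (𝓝 0) := by
      have h2 := (Lp.tendsto_Lp_iff_tendsto_eLpNorm' S G).1 hG
      refine tendsto_of_tendsto_of_tendsto_of_le_of_le tendsto_const_nhds h2
        (fun _ => zero_le) fun m => ?_
      refine (eLpNorm_le_eLpNorm_of_exponent_le (one_le_two : (1 : ℝ≥0∞) ≤ 2)
        ((c1 m).aestronglyMeasurable.sub hGi.1)).trans ?_
      refine eLpNorm_mono_ae ?_
      filter_upwards [MemLp.coeFn_toLp (memLp_of_continuous (continuous_mollGrad m hu) 2)]
        with x hx
      simp only [Pi.sub_apply, S, hx]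
      exact PiLp.norm_apply_le (mollGrad m u x - G x) i
    have l2 := tendsto_integral_mul_of_tendsto_eLpNorm
      (fun m => integrable_of_continuous (c1 m)) hGi hφ.continuous hconv
    refine tendsto_nhds_unique (l1.congr fun m => ?_) l2.neg
    exact ((hs m).hasPartial_conv hu i).integral_mul (hφ.hasPartial i)
      (continuous_conv (hs m).continuous hu) (c1 m) hφ.continuous (hφ.pderiv i).continuous
  · have h1 : ‖G‖ ^ 2 ≤ K * ∫ x, |L x| :=
      le_of_tendsto' ((hG.norm).pow 2) fun m => norm_sq_mollGrad_le hu hL hK hlap m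
    have hL1 := (memLp_one_iff_integrable.2 hL).2.ne
    rw [Lp.norm_def, integral_abs_eq_toReal hL.1] at h1
    rw [← ENNReal.ofReal_toReal (Lp.memLp G).2.ne, ← ENNReal.ofReal_pow ENNReal.toReal_nonneg,
      ← ENNReal.ofReal_toReal hL1, ← ENNReal.ofReal_mul ENNReal.toReal_nonneg]
    refine ENNReal.ofReal_le_ofReal (h1.trans (le_of_eq (mul_comm _ _)))

end Interpolation

/-! ### Uniqueness of weak gradients and time slices of the Laplacian -/

theorem ae_eq_of_conv_mollifier_eq {v v' : Torus n → ℝ} (hv : Integrable v) (hv' : Integrable v')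
    (h : ∀ m x, conv (mollifier m) v x = conv (mollifier m) v' x) : v =ᵐ[volume] v' := by
  have hd := hv.sub hv'
  have h1 := tendsto_eLpNorm_conv_mollifier le_rfl ENNReal.one_ne_top
    (memLp_one_iff_integrable.2 hd)
  -- The mollifications of `v - v'` vanish, so its mollification error is a constant sequence, which
  -- must be zero.
  have h2 : ∀ m, eLpNorm (fun x => conv (mollifier m) (v - v') x - (v - v') x) 1 volume =
      eLpNorm (v - v') 1 volume := fun m => by
    have e : (fun x => conv (mollifier m) (v - v') x - (v - v') x) = -(v - v') := by
      ext x
      have := conv_sub (isSmooth_mollifier m).continuous hv hv' x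
      rw [h, sub_self] at this
      rw [show conv (mollifier m) (v - v') x = 0 from this, zero_sub]
      rfl
    rw [e, eLpNorm_neg]
  simp only [h2] at h1
  have h3 := tendsto_nhds_unique tendsto_const_nhds h1
  rw [eLpNorm_eq_zero_iff hd.1 one_ne_zero] at h3
  filter_upwards [h3] with x hx
  exact sub_eq_zero.1 hx

theorem IsWeakGradient.ae_eq {v : Torus n → ℝ} {G G' : Torus n → Vec n}
    (h : IsWeakGradient v G) (h' : IsWeakGradient v G') : G =ᵐ[volume] G' := by
  have hi : ∀ i, (fun x => G x i) =ᵐ[volume] fun x => G' x i := fun i => by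
    refine ae_eq_of_conv_mollifier_eq ((EuclideanSpace.proj (𝕜 := ℝ) i).integrable_comp h.2.1)
      ((EuclideanSpace.proj (𝕜 := ℝ) i).integrable_comp h'.2.1) fun m x => ?_
    rw [← h.conv_pderiv (isSmooth_mollifier m), ← h'.conv_pderiv (isSmooth_mollifier m)]
  filter_upwards [ae_all_iff.2 hi] with x hx
  exact PiLp.ext hx

theorem IsWeakLaplacian.conv_laplacian_eq {v L : Torus n → ℝ} (h : IsWeakLaplacian v L)
    {ρ : Torus n → ℝ} (hρ : IsSmooth ρ) (x : Torus n) :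
    conv (laplacian ρ) v x = conv ρ L x := by
  have h1 := h.2.2 _ (hρ.const_sub x)
  rw [hρ.laplacian_const_sub] at h1
  simpa only [conv, mul_comm] using h1

theorem exists_Icc_of_isCompact_subset_Ioo {s : Set ℝ} {T : ℝ} (hs : IsCompact s)
    (h : s ⊆ Ioo 0 T) : ∃ a b, 0 < a ∧ b < T ∧ s ⊆ Icc a b := by
  rcases s.eq_empty_or_nonempty with rfl | hne
  · exact ⟨1, T - 1, one_pos, by linarith, empty_subset _⟩
  · obtain ⟨a, ha⟩ := hs.exists_isLeast hne
    obtain ⟨b, hb⟩ := hs.exists_isGreatest hne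
    exact ⟨a, b, (h ha.1).1, (h hb.1).2, fun x hx => ⟨ha.2 hx, hb.2 hx⟩⟩

/-- Product test functions `g(t) ρ(x - y)` give the identity for almost every `t` once `m` and `x`
are fixed. -/
theorem IsWeakLaplacianCyl.ae_conv_laplacian_eq {T : ℝ} {w L : ℝ → Torus n → ℝ}
    (h : IsWeakLaplacianCyl T w L) : ∀ᵐ t ∂(volume.restrict (Ioo 0 T)),
      ∀ m x, conv (laplacian (mollifier m)) (w t) x = conv (mollifier m) (L t) x := by
  obtain ⟨hw, hL, heq⟩ := h
  have hpt : ∀ {ρ : Torus n → ℝ}, IsSmooth ρ → ∀ x, ∀ᵐ t ∂(volume.restrict (Ioo 0 T)),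
      conv (laplacian ρ) (w t) x = conv ρ (L t) x := by
    intro ρ hρ x
    have i1 : IntegrableOn (fun t => conv (laplacian ρ) (w t) x) (Ioo 0 T) :=
      integrable_conv_left hρ.laplacian.continuous hw x
    have i2 : IntegrableOn (fun t => conv ρ (L t) x) (Ioo 0 T) :=
      integrable_conv_left hρ.continuous hL x
    rw [ae_restrict_iff' measurableSet_Ioo]
    have key := isOpen_Ioo.ae_eq_zero_of_integral_contDiff_smul_eq_zero
      (i1.sub i2).locallyIntegrableOn fun g hg hgc hgs => ?_
    · exact key.mono fun t ht ht' => sub_eq_zero.1 (ht ht')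
    obtain ⟨a, b, ha, hb, hab⟩ := exists_Icc_of_isCompact_subset_Ioo hgc hgs
    have hg0 : ∀ t, t ∉ Icc a b → g t = 0 := fun t ht =>
      image_eq_zero_of_notMem_tsupport fun h' => ht (hab h')
    have h1 := heq _ ((hρ.const_sub x).isTestFunction hg ha hb hg0)
    have d : ∀ t y, laplacian (fun y => g t * ρ (x - y)) y = g t * laplacian ρ (x - y) := by
      intro t y
      have d1 : ∀ i, pderiv i (fun y => g t * ρ (x - y)) =
          fun y => g t * -pderiv i ρ (x - y) := fun i =>
        HasPartial.pderiv_eq fun y => (hρ.hasPartial_const_sub i x y).const_mul (g t)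
      have d2 : ∀ i, pderiv i (fun y => g t * -pderiv i ρ (x - y)) =
          fun y => g t * pderiv i (pderiv i ρ) (x - y) := fun i =>
        HasPartial.pderiv_eq fun y => by
          simpa using (((hρ.pderiv i).hasPartial_const_sub i x y).fun_neg).const_mul (g t)
      simp only [laplacian, d1, d2, Finset.mul_sum]
    simp only [d] at h1
    obtain ⟨C, hC⟩ := exists_ae_bound_cyl (n := n) T (hg.continuous.comp continuous_fst)
    have hprod : ∀ {q : ℝ × Torus n → ℝ} {κ : Torus n → ℝ}, Integrable q (cyl n T) →
        Continuous κ → Integrable (fun z => q z * (g z.1 * κ (x - z.2))) (cyl n T) := by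
      intro q κ hq hκ
      obtain ⟨C', -, hC'⟩ := exists_bound_of_continuous hκ
      refine hq.mul_bdd (c := C * C') ?_ ?_
      · exact ((hg.continuous.comp continuous_fst).mul
          (hκ.comp (continuous_const.sub continuous_snd))).aestronglyMeasurable
      · filter_upwards [hC] with z hz
        rw [norm_mul]
        exact mul_le_mul hz (hC' _) (norm_nonneg _) ((norm_nonneg _).trans hz)
    have I1 := hprod hw hρ.laplacian.continuous
    have I2 := hprod hL hρ.continuous
    unfold cyl at h1 I1 I2
    rw [integral_prod _ I1, integral_prod _ I2] at h1
    have e : ∀ (q : ℝ → Torus n → ℝ) (κ : Torus n → ℝ) (t : ℝ),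
        ∫ y, q t y * (g t * κ (x - y)) = g t * conv κ (q t) x := by
      intro q κ t
      unfold conv
      rw [← integral_const_mul]
      exact integral_congr_ae (Eventually.of_forall fun y => by ring)
    simp only [e] at h1
    have hbg : ∀ᵐ t ∂(volume.restrict (Ioo 0 T)), ‖g t‖ ≤ C := by
      have h2 : ∀ᵐ t ∂(volume.restrict (Ioo 0 T)), ∀ᵐ y : Torus n, ‖g t‖ ≤ C :=
        Measure.ae_ae_of_ae_prod hC
      exact h2.mono fun t ht => ht.exists.choose_spec
    have j1 := i1.bdd_mul hg.continuous.aestronglyMeasurable hbg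
    have j2 := i2.bdd_mul hg.continuous.aestronglyMeasurable hbg
    rw [← sub_eq_zero, ← integral_sub j1 j2] at h1
    rw [← h1, setIntegral_eq_integral_of_forall_compl_eq_zero]
    · refine integral_congr_ae (Eventually.of_forall fun t => ?_)
      simp only [smul_eq_mul, Pi.sub_apply, mul_sub]
    · intro t ht
      rw [hg0 t fun h' => ht ⟨ha.trans_le h'.1, h'.2.trans_lt hb⟩, zero_mul, zero_mul, sub_zero]
  -- The exceptional null set depends on `x`: a countable dense set of points yields a common one,
  -- and continuity of both convolutions covers the remaining `x`.
  obtain ⟨s, hsc, hsd⟩ := TopologicalSpace.exists_countable_dense (Torus n)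
  have hall : ∀ᵐ t ∂(volume.restrict (Ioo 0 T)), ∀ m : ℕ, ∀ x ∈ s,
      conv (laplacian (mollifier m)) (w t) x = conv (mollifier m) (L t) x :=
    ae_all_iff.2 fun m => (ae_ball_iff hsc).2 fun x _ => hpt (isSmooth_mollifier m) x
  have sw : ∀ᵐ t ∂(volume.restrict (Ioo 0 T)), Integrable (w t) := hw.prod_right_ae
  have sL : ∀ᵐ t ∂(volume.restrict (Ioo 0 T)), Integrable (L t) := hL.prod_right_ae
  filter_upwards [hall, sw, sL] with t ht hwt hLt m x
  exact congrFun (Continuous.ext_on hsd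
    (continuous_conv (isSmooth_mollifier m).laplacian.continuous hwt)
    (continuous_conv (isSmooth_mollifier m).continuous hLt) fun y hy => ht m y hy) x

/-! ### The linear equation satisfied by the difference of two solutions -/

/-- The fundamental theorem of calculus on the segment from `q` to `p`. Continuity of the gradient
makes the vector integral genuine, so it can be pulled through the inner product. -/
theorem sub_eq_inner_integral_gradient {E : Type*} [NormedAddCommGroup E] [InnerProductSpace ℝ E]
    [CompleteSpace E] {H : E → ℝ} (hH : ContDiff ℝ 1 H) (p q : E) :
    H p - H q = inner ℝ (p - q) (∫ θ in (0 : ℝ)..1, gradient H (θ • p + (1 - θ) • q)) := by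
  have hg : Continuous (gradient H) :=
    (InnerProductSpace.toDual ℝ E).symm.continuous.comp (hH.continuous_fderiv one_ne_zero)
  have hl : Continuous fun θ : ℝ => θ • p + (1 - θ) • q := by fun_prop
  have hd : ∀ θ : ℝ, HasDerivAt (fun θ : ℝ => H (θ • p + (1 - θ) • q))
      (innerSL ℝ (p - q) (gradient H (θ • p + (1 - θ) • q))) θ := by
    intro θ
    have h1 : HasDerivAt (fun θ : ℝ => θ • p + (1 - θ) • q) (p - q) θ := by
      have := ((hasDerivAt_id θ).smul_const p).fun_add
        (((hasDerivAt_id θ).const_sub 1).smul_const q)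
      simpa [sub_eq_add_neg] using this
    have h2 := (hH.differentiable one_ne_zero (θ • p + (1 - θ) • q)).hasGradientAt.hasFDerivAt
    have h3 : HasDerivAt (fun θ : ℝ => H (θ • p + (1 - θ) • q)) _ θ := h2.comp_hasDerivAt θ h1
    rwa [InnerProductSpace.toDual_apply_apply, real_inner_comm] at h3
  have hgi : IntervalIntegrable (fun θ : ℝ => gradient H (θ • p + (1 - θ) • q)) volume 0 1 :=
    (hg.comp hl).intervalIntegrable _ _
  have h4 := intervalIntegral.integral_eq_sub_of_hasDerivAt (a := 0) (b := 1)
    (fun θ _ => hd θ) (((innerSL ℝ (p - q)).continuous.comp (hg.comp hl)).intervalIntegrable _ _)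
  rw [ContinuousLinearMap.intervalIntegral_comp_comm _ hgi] at h4
  simp only [innerSL_apply_apply, one_smul, sub_self, zero_smul, add_zero, sub_zero, zero_add] at h4
  exact h4.symm

/-! ### Test functions on the cylinder and products with locally integrable terms -/

theorem isOpenQuotientMap_prodMap_proj :
    IsOpenQuotientMap (Prod.map id proj : ℝ × Vec n → ℝ × Torus n) :=
  IsOpenQuotientMap.id.prodMap isOpenQuotientMap_proj

section TestFunction

variable {T : ℝ} {φ : ℝ → Torus n → ℝ}

theorem IsTestFunction.continuous (h : IsTestFunction T φ) :
    Continuous fun z : ℝ × Torus n => φ z.1 z.2 :=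
  isOpenQuotientMap_prodMap_proj.isQuotientMap.continuous_iff.2 h.1.continuous

theorem IsTestFunction.continuous_deriv (h : IsTestFunction T φ) :
    Continuous fun z : ℝ × Torus n => deriv (fun s => φ s z.2) z.1 := by
  refine isOpenQuotientMap_prodMap_proj.isQuotientMap.continuous_iff.2 ?_
  have e : (fun z : ℝ × Torus n => deriv (fun s => φ s z.2) z.1) ∘ Prod.map id proj =
      fun z : ℝ × Vec n => fderiv ℝ (fun z : ℝ × Vec n => φ z.1 (proj z.2)) z (1, 0) := by
    ext z
    have h1 := (h.1.differentiable (by simp) z).hasFDerivAt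
    have h2 : HasDerivAt (fun s : ℝ => (s, z.2)) ((1 : ℝ), (0 : Vec n)) z.1 :=
      (hasDerivAt_id z.1).prodMk (hasDerivAt_const z.1 z.2)
    exact (h1.comp_hasDerivAt z.1 h2).deriv
  rw [e]
  exact (h.1.continuous_fderiv (by simp)).clm_apply continuous_const

theorem IsTestFunction.continuous_pderiv (h : IsTestFunction T φ) (i : Fin n) :
    Continuous fun z : ℝ × Torus n => pderiv i (φ z.1) z.2 := by
  refine isOpenQuotientMap_prodMap_proj.isQuotientMap.continuous_iff.2 ?_
  have e : (fun z : ℝ × Torus n => pderiv i (φ z.1) z.2) ∘ Prod.map id proj =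
      fun z : ℝ × Vec n => fderiv ℝ (fun z : ℝ × Vec n => φ z.1 (proj z.2)) z
        (0, EuclideanSpace.single i 1) := by
    ext z
    have h1 := (h.1.differentiable (by simp) z).hasFDerivAt
    have hs : IsSmooth (φ z.1) :=
      h.1.comp (contDiff_const.prodMk contDiff_id : ContDiff ℝ ∞ fun y : Vec n => (z.1, y))
    have h2 : HasFDerivAt (fun y : Vec n => (z.1, y))
        (ContinuousLinearMap.inr ℝ ℝ (Vec n)) z.2 := hasFDerivAt_prodMk_right z.1 z.2
    have h3 := HasFDerivAt.comp z.2 h1 h2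
    change pderiv i (φ z.1) (proj z.2) = _
    rw [hs.pderiv_proj]
    have h4 := h3.fderiv
    change fderiv ℝ (fun y : Vec n => φ z.1 (proj y)) z.2 = _ at h4
    rw [h4]
    rfl
  rw [e]
  exact (h.1.continuous_fderiv (by simp)).clm_apply continuous_const

end TestFunction

theorem integrable_mul_cyl_of_continuous {T : ℝ} {q g : ℝ × Torus n → ℝ}
    (hq : Integrable q (cyl n T)) (hg : Continuous g) :
    Integrable (fun z => q z * g z) (cyl n T) := by
  obtain ⟨C, hC⟩ := exists_ae_bound_cyl T hg
  exact hq.mul_bdd hg.aestronglyMeasurable hC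

theorem restrict_prod_eq (s : Set ℝ) :
    (volume.restrict s).prod (volume : Measure (Torus n)) =
      ((volume : Measure ℝ).prod volume).restrict (s ×ˢ univ) := by
  rw [← Measure.prod_restrict, Measure.restrict_univ]

theorem integrable_mul_cyl_of_local {T : ℝ} {q g : ℝ × Torus n → ℝ}
    (hq : ∀ a b : ℝ, 0 < a → b < T → Integrable q ((volume.restrict (Ioo a b)).prod volume))
    (hg : Continuous g) {a b : ℝ} (ha : 0 < a) (hb : b < T)
    (h0 : ∀ z : ℝ × Torus n, z.1 ∉ Icc a b → g z = 0) :
    Integrable (fun z => q z * g z) (cyl n T) := by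
  -- Halving the gaps to `0` and `T` gives an open interval still compactly inside `(0, T)` and
  -- containing the closed time support.
  have hle : (volume.restrict (Ioo (a / 2) ((b + T) / 2))).prod (volume : Measure (Torus n)) ≤
      cyl n T := Measure.prod_mono
    (Measure.restrict_mono (Ioo_subset_Ioo (by linarith) (by linarith)) le_rfl) le_rfl
  obtain ⟨C, hC⟩ := exists_ae_bound_cyl (n := n) T hg
  have h1 := (hq (a / 2) ((b + T) / 2) (by linarith) (by linarith)).mul_bdd
    hg.aestronglyMeasurable (ae_mono hle hC)
  rw [restrict_prod_eq] at h1
  have h2 : Integrable (fun z => q z * g z) ((volume : Measure ℝ).prod volume) := by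
    refine IntegrableOn.integrable_of_forall_notMem_eq_zero h1 fun z hz => ?_
    rw [h0 z, mul_zero]
    intro hz'
    exact hz ⟨⟨by linarith [hz'.1], by linarith [hz'.2]⟩, mem_univ _⟩
  unfold cyl
  rw [restrict_prod_eq]
  exact h2.integrableOn

/-- `(0, T)` is exhausted by countably many compactly contained intervals. This serves `H(x,t,Du)`,
which is given only away from the end points. -/
theorem aestronglyMeasurable_cyl_of_local {T : ℝ} {q : ℝ × Torus n → ℝ}
    (hq : ∀ a b : ℝ, 0 < a → b < T →
      AEStronglyMeasurable q ((volume.restrict (Ioo a b)).prod volume)) :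
    AEStronglyMeasurable q (cyl n T) := by
  have hU : Ioo 0 T ×ˢ (univ : Set (Torus n)) =
      ⋃ k : ℕ, Ioo (1 / ((k : ℝ) + 1)) (T - 1 / ((k : ℝ) + 1)) ×ˢ (univ : Set (Torus n)) := by
    ext z
    simp only [mem_prod, mem_univ, and_true, mem_iUnion]
    constructor
    · intro hz
      have hpos : 0 < min z.1 (T - z.1) := lt_min hz.1 (by linarith [hz.2])
      obtain ⟨k, hk⟩ := exists_nat_one_div_lt hpos
      have h1 := hk.trans_le (min_le_left _ _)
      have h2 := hk.trans_le (min_le_right _ _)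
      exact ⟨k, h1, by linarith⟩
    · rintro ⟨k, h1, h2⟩
      have : 0 < 1 / ((k : ℝ) + 1) := Nat.one_div_pos_of_nat
      exact ⟨by linarith, by linarith⟩
  unfold cyl
  rw [restrict_prod_eq, hU, aestronglyMeasurable_iUnion_iff]
  intro k
  have hk : 0 < 1 / ((k : ℝ) + 1) := Nat.one_div_pos_of_nat
  rw [← restrict_prod_eq]
  exact hq _ _ hk (by linarith)

theorem MemL1Linf.integrable {T : ℝ} {f : ℝ → Torus n → ℝ} (h : MemL1Linf T f) :
    Integrable (fun z : ℝ × Torus n => f z.1 z.2) (cyl n T) := by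
  refine ⟨h.1, ?_⟩
  have hs : ∀ᵐ t ∂(volume.restrict (Ioo 0 T)), AEStronglyMeasurable (f t) volume :=
    h.1.prodMk_left
  unfold HasFiniteIntegral cyl
  rw [lintegral_prod _ h.1.enorm]
  refine lt_of_le_of_lt (lintegral_mono_ae (hs.mono fun t ht => ?_)) h.2
  rw [← eLpNorm_one_eq_lintegral_enorm (f := f t)]
  exact eLpNorm_le_eLpNorm_of_exponent_le le_top ht

theorem IsWeakGradient.sub {v v' : Torus n → ℝ} {G G' : Torus n → Vec n}
    (h : IsWeakGradient v G) (h' : IsWeakGradient v' G') :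
    IsWeakGradient (v - v') (G - G') := by
  refine ⟨h.1.sub h'.1, h.2.1.sub h'.2.1, fun φ hφ i => ?_⟩
  have b : ∀ {q ψ : Torus n → ℝ}, Integrable q → Continuous ψ → Integrable fun x => q x * ψ x :=
    fun {q ψ} hq hψ => by
      obtain ⟨C, -, hC⟩ := exists_bound_of_continuous hψ
      exact hq.mul_bdd hψ.aestronglyMeasurable (Eventually.of_forall hC)
  have g : Integrable fun x => G x i := (EuclideanSpace.proj (𝕜 := ℝ) i).integrable_comp h.2.1
  have g' : Integrable fun x => G' x i := (EuclideanSpace.proj (𝕜 := ℝ) i).integrable_comp h'.2.1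
  have e1 := h.2.2 φ hφ i
  have e2 := h'.2.2 φ hφ i
  simp only [Pi.sub_apply, PiLp.sub_apply, sub_mul]
  rw [integral_sub (b h.1 (hφ.pderiv i).continuous) (b h'.1 (hφ.pderiv i).continuous),
    integral_sub (b g hφ.continuous) (b g' hφ.continuous), e1, e2]
  ring

/-- A curve in `C([0,T]; L²)`, extended to `ℝ` by its end points. -/
def curveL2 {T : ℝ} (hT : 0 < T) {w : ℝ → Torus n → ℝ}
    (hw : ∀ t ∈ Icc 0 T, MemLp (w t) 2 volume) (t : ℝ) : Lp ℝ 2 (volume : Measure (Torus n)) :=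
  (hw _ (projIcc 0 T hT.le t).2).toLp _

theorem curveL2_ae_eq {T : ℝ} (hT : 0 < T) {w : ℝ → Torus n → ℝ}
    (hw : ∀ t ∈ Icc 0 T, MemLp (w t) 2 volume) {t : ℝ} (ht : t ∈ Icc 0 T) :
    curveL2 hT hw t =ᵐ[volume] w t := by
  have h := MemLp.coeFn_toLp (hw _ (projIcc 0 T hT.le t).2)
  have e : ((projIcc 0 T hT.le t : Icc 0 T) : ℝ) = t := by rw [projIcc_of_mem _ ht]
  unfold curveL2
  refine h.trans ?_
  rw [e]

theorem continuous_curveL2 {T : ℝ} (hT : 0 < T) {w : ℝ → Torus n → ℝ}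
    (hw : ∀ t ∈ Icc 0 T, MemLp (w t) 2 volume)
    (hc : ∀ t₀ ∈ Icc 0 T,
      Tendsto (fun t => eLpNorm (w t - w t₀) 2 volume) (𝓝[Icc 0 T] t₀) (𝓝 0)) :
    Continuous (curveL2 hT hw) := by
  have h : Continuous fun t : Icc (0 : ℝ) T => (hw t t.2).toLp (w t) := by
    rw [continuous_iff_continuousAt]
    intro t₀
    have h1 : Tendsto (fun t : Icc (0 : ℝ) T => (t : ℝ)) (𝓝 t₀) (𝓝[Icc 0 T] (t₀ : ℝ)) :=
      tendsto_nhdsWithin_iff.2 ⟨continuous_subtype_val.tendsto t₀,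
        Eventually.of_forall fun t => t.2⟩
    exact (Lp.tendsto_Lp_iff_tendsto_eLpNorm'' _ (fun t : Icc (0 : ℝ) T => hw t t.2) _
      (hw t₀ t₀.2)).2 ((hc t₀ t₀.2).comp h1)
  exact h.comp continuous_projIcc

section Difference

variable {ε T M : ℝ} {H : Torus n → ℝ → Vec n → ℝ} {f₁ f₂ : ℝ → Torus n → ℝ}
  {g₁ g₂ : Torus n → ℝ} {u₁ u₂ : ℝ → Torus n → ℝ} {Du₁ Du₂ : ℝ → Torus n → Vec n}

theorem IsEnergySolution.memLp_slice_sub (hu₁ : IsEnergySolution ε T H f₁ g₁ u₁ Du₁)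
    (hu₂ : IsEnergySolution ε T H f₂ g₂ u₂ Du₂) : ∀ t ∈ Icc 0 T, MemLp (u₁ t - u₂ t) 2 volume :=
  fun t ht => (hu₁.memLp_slice t ht).sub (hu₂.memLp_slice t ht)

theorem IsEnergySolution.continuous_L2_sub (hu₁ : IsEnergySolution ε T H f₁ g₁ u₁ Du₁)
    (hu₂ : IsEnergySolution ε T H f₂ g₂ u₂ Du₂) : ∀ t₀ ∈ Icc 0 T,
      Tendsto (fun t => eLpNorm ((u₁ t - u₂ t) - (u₁ t₀ - u₂ t₀)) 2 volume) (𝓝[Icc 0 T] t₀)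
        (𝓝 0) := by
  intro t₀ ht₀
  have h := (hu₁.continuous_L2 t₀ ht₀).add (hu₂.continuous_L2 t₀ ht₀)
  rw [add_zero] at h
  refine tendsto_of_tendsto_of_tendsto_of_le_of_le' tendsto_const_nhds h
    (Eventually.of_forall fun _ => zero_le) ?_
  filter_upwards [self_mem_nhdsWithin] with t ht
  rw [sub_sub_sub_comm]
  exact eLpNorm_sub_le ((hu₁.memLp_slice t ht).1.sub (hu₁.memLp_slice t₀ ht₀).1)
    ((hu₂.memLp_slice t ht).1.sub (hu₂.memLp_slice t₀ ht₀).1) one_le_two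

theorem abs_hamiltonian_sub_le (hH : ∀ᵐ z ∂(cyl n T), ContDiff ℝ 1 (H z.2 z.1))
    (hb : ∀ᵐ z ∂(cyl n T), ‖drift H Du₁ Du₂ z.1 z.2‖ ≤ M) :
    ∀ᵐ z ∂(cyl n T), |H z.2 z.1 (Du₁ z.1 z.2) - H z.2 z.1 (Du₂ z.1 z.2)| ≤
      M * ‖(Du₁ z.1 - Du₂ z.1) z.2‖ := by
  filter_upwards [hH, hb] with z h1 h2
  rw [sub_eq_inner_integral_gradient h1, mul_comm]
  exact (abs_real_inner_le_norm _ _).trans (mul_le_mul_of_nonneg_left h2 (norm_nonneg _))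

/-- Each Hamiltonian term is only locally integrable in time, but the drift bound puts their
difference in `L²(Q_T)`, as the energy estimate requires. -/
theorem IsEnergySolution.isLinearSolution_sub (hT : 0 < T) (hf₁ : MemL1Linf T f₁)
    (hf₂ : MemL1Linf T f₂) (hu₁ : IsEnergySolution ε T H f₁ g₁ u₁ Du₁)
    (hu₂ : IsEnergySolution ε T H f₂ g₂ u₂ Du₂)
    (hb : ∀ᵐ z ∂(cyl n T), |H z.2 z.1 (Du₁ z.1 z.2) - H z.2 z.1 (Du₂ z.1 z.2)| ≤
      M * ‖(Du₁ z.1 - Du₂ z.1) z.2‖) :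
    IsLinearSolution ε T (fun t => u₁ t - u₂ t)
      (fun t x => H x t (Du₁ t x) - H x t (Du₂ t x)) (fun t => f₁ t - f₂ t)
      (fun t => Du₁ t - Du₂ t) (curveL2 hT (hu₁.memLp_slice_sub hu₂)) := by
  have hDm : MemLp (fun z : ℝ × Torus n => (Du₁ z.1 - Du₂ z.1) z.2) 2 (cyl n T) :=
    hu₁.memLp_grad.sub hu₂.memLp_grad
  refine ⟨continuous_curveL2 hT _ (hu₁.continuous_L2_sub hu₂),
    fun t ht => curveL2_ae_eq hT _ ht, hu₁.memLp.sub hu₂.memLp, hDm, ?_, ?_,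
    hf₁.integrable.sub hf₂.integrable, fun φ hφ => ?_⟩
  · filter_upwards [hu₁.isWeakGradient, hu₂.isWeakGradient] with t h1 h2 using h1.sub h2
  · refine MemLp.of_le_mul hDm ?_ (c := M) hb
    exact (aestronglyMeasurable_cyl_of_local fun a b ha hb => (hu₁.integrable_H a b ha hb).1).sub
      (aestronglyMeasurable_cyl_of_local fun a b ha hb => (hu₂.integrable_H a b ha hb).1)
  · obtain ⟨a, b, ha, hb', h0⟩ := hφ.2
    have key : ∀ {f g u Du}, MemL1Linf T f → IsEnergySolution ε T H f g u Du →
        Integrable (fun z : ℝ × Torus n => u z.1 z.2 * deriv (fun s => φ s z.2) z.1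
          + ε * ∑ i, Du z.1 z.2 i * pderiv i (φ z.1) z.2
          + H z.2 z.1 (Du z.1 z.2) * φ z.1 z.2) (cyl n T) := by
      intro f g u Du hf hu
      refine ((integrable_mul_cyl_of_continuous (hu.memLp.integrable one_le_two)
        hφ.continuous_deriv).add ((integrable_finsetSum _ fun i _ => ?_).const_mul ε)).add
        (integrable_mul_cyl_of_local hu.integrable_H hφ.continuous ha hb'
          fun z hz => h0 z.1 hz z.2)
      refine integrable_mul_cyl_of_continuous ?_ (hφ.continuous_pderiv i)
      exact (EuclideanSpace.proj (𝕜 := ℝ) i).integrable_comp (hu.memLp_grad.integrable one_le_two)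
    have e1 := hu₁.equation φ hφ
    have e2 := hu₂.equation φ hφ
    have r1 := integrable_mul_cyl_of_continuous hf₁.integrable hφ.continuous
    have r2 := integrable_mul_cyl_of_continuous hf₂.integrable hφ.continuous
    have e3 := congrArg₂ (· - ·) e1 e2
    simp only at e3
    rw [← integral_sub (key hf₁ hu₁) (key hf₂ hu₂), ← integral_sub r1 r2] at e3
    convert e3 using 3 with z z
    · simp only [Pi.sub_apply, PiLp.sub_apply, sub_mul, Finset.sum_sub_distrib]
      ring
    · simp only [Pi.sub_apply, sub_mul]

end Difference

/-- Turns the one-sided estimate into a two-sided one. -/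
theorem IsLinearSolution.neg {ε T : ℝ} {w h f : ℝ → Torus n → ℝ} {D : ℝ → Torus n → Vec n}
    {W : ℝ → Lp ℝ 2 (volume : Measure (Torus n))} (hw : IsLinearSolution ε T w h f D W) :
    IsLinearSolution ε T (fun t => -w t) (fun t => -h t) (fun t => -f t) (fun t => -D t)
      (fun t => -W t) := by
  refine ⟨hw.continuous.neg, fun t ht => ?_, hw.memLp.neg, hw.memLp_grad.neg, ?_,
    hw.memLp_h.neg, hw.integrable_f.neg, fun φ hφ => ?_⟩
  · filter_upwards [Lp.coeFn_neg (W t), hw.ae_eq t ht] with x h1 h2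
    rw [h1, Pi.neg_apply, Pi.neg_apply, h2]
  · filter_upwards [hw.isWeakGradient] with t ht
    refine ⟨ht.1.neg, ht.2.1.neg, fun φ hφ i => ?_⟩
    have := ht.2.2 φ hφ i
    simp only [Pi.neg_apply, PiLp.neg_apply, neg_mul, integral_neg, this]
  · have h1 := congrArg Neg.neg (hw.equation φ hφ)
    rw [← integral_neg, ← integral_neg] at h1
    convert h1 using 3 with z z
    · simp only [Pi.neg_apply, PiLp.neg_apply, neg_mul, Finset.sum_neg_distrib]
      ring
    · simp only [Pi.neg_apply, neg_mul]

/-! ### The sup-norm estimate for the difference of two solutions -/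

/-- The essential supremum of a slice is at most `c` exactly when the slice of `{|f| > c}` is null,
and the measure of slices is measurable. -/
theorem measurable_eLpNorm_top_slice {f : ℝ × Torus n → ℝ} (hf : Measurable f) :
    Measurable fun t => eLpNorm (fun x => f (t, x)) ⊤ volume := by
  refine measurable_of_Iic fun c => ?_
  have hS : MeasurableSet {z : ℝ × Torus n | c < ‖f z‖ₑ} :=
    measurableSet_lt measurable_const hf.enorm
  have h1 := (measurable_measure_prodMk_left (ν := (volume : Measure (Torus n))) hS)
    (measurableSet_singleton 0)
  convert h1 using 1
  ext t
  simp only [mem_preimage, mem_Iic, mem_singleton_iff, eLpNorm_exponent_top]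
  constructor
  · intro h
    have h2 : ∀ᵐ x : Torus n, ‖f (t, x)‖ₑ ≤ c :=
      (enorm_ae_le_eLpNormEssSup (fun x => f (t, x)) volume).mono fun x hx => hx.trans h
    rw [ae_iff] at h2
    simp only [not_le] at h2
    exact h2
  · intro h
    refine essSup_le_of_ae_le c ?_
    have h2 : ∀ᵐ x : Torus n, ‖f (t, x)‖ₑ ≤ c := by
      rw [ae_iff]
      simp only [not_le]
      exact h
    exact h2

theorem aemeasurable_eLpNorm_top_slice {T : ℝ} {f : ℝ → Torus n → ℝ}
    (hf : AEStronglyMeasurable (fun z : ℝ × Torus n => f z.1 z.2) (cyl n T)) :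
    AEMeasurable (fun t => eLpNorm (f t) ⊤ volume) (volume.restrict (Ioo 0 T)) := by
  refine ⟨_, measurable_eLpNorm_top_slice hf.stronglyMeasurable_mk.measurable, ?_⟩
  have h1 : ∀ᵐ t ∂(volume.restrict (Ioo 0 T)), ∀ᵐ x, f t x = hf.mk _ (t, x) :=
    Measure.ae_ae_of_ae_prod hf.ae_eq_mk
  exact h1.mono fun t ht => eLpNorm_congr_ae ht

theorem dataDist_ne_top {T : ℝ} {f₁ f₂ : ℝ → Torus n → ℝ} {g₁ g₂ : Torus n → ℝ}
    (hg₁ : MemLp g₁ ⊤ volume) (hg₂ : MemLp g₂ ⊤ volume) (hf₁ : MemL1Linf T f₁)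
    (hf₂ : MemL1Linf T f₂) : dataDist T f₁ f₂ g₁ g₂ ≠ ⊤ := by
  have m1 : ∀ᵐ t ∂(volume.restrict (Ioo 0 T)), AEStronglyMeasurable (f₁ t) volume :=
    hf₁.1.prodMk_left
  have m2 : ∀ᵐ t ∂(volume.restrict (Ioo 0 T)), AEStronglyMeasurable (f₂ t) volume :=
    hf₂.1.prodMk_left
  refine ENNReal.add_ne_top.2 ⟨(hg₁.sub hg₂).2.ne, ne_of_lt ?_⟩
  calc ∫⁻ t in Ioo 0 T, eLpNorm (f₁ t - f₂ t) ⊤ volume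
      ≤ ∫⁻ t in Ioo 0 T, (eLpNorm (f₁ t) ⊤ volume + eLpNorm (f₂ t) ⊤ volume) := by
        refine lintegral_mono_ae ?_
        filter_upwards [m1, m2] with t h1 h2
        exact eLpNorm_sub_le h1 h2 le_top
    _ = (∫⁻ t in Ioo 0 T, eLpNorm (f₁ t) ⊤ volume) + ∫⁻ t in Ioo 0 T, eLpNorm (f₂ t) ⊤ volume :=
        lintegral_add_left' (aemeasurable_eLpNorm_top_slice hf₁.1) _
    _ < ⊤ := ENNReal.add_lt_top.2 ⟨hf₁.2, hf₂.2⟩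

theorem ae_abs_le_toReal_eLpNorm_top {v : Torus n → ℝ} (hv : eLpNorm v ⊤ volume ≠ ⊤) :
    ∀ᵐ x, |v x| ≤ (eLpNorm v ⊤ volume).toReal := by
  filter_upwards [enorm_ae_le_eLpNormEssSup v volume] with x hx
  rw [← eLpNorm_exponent_top] at hx
  have := ENNReal.toReal_mono hv hx
  rwa [toReal_enorm, Real.norm_eq_abs] at this

section Estimate

variable {ε T M : ℝ} {H : Torus n → ℝ → Vec n → ℝ} {f₁ f₂ : ℝ → Torus n → ℝ}
  {g₁ g₂ : Torus n → ℝ} {u₁ u₂ : ℝ → Torus n → ℝ} {Du₁ Du₂ : ℝ → Torus n → Vec n}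

/-- Comparison applied to `w` and `-w`, with `F` the sup norm of `f₁(t) - f₂(t)`, extended by zero,
and `G` that of `g₁ - g₂`. The bound holds at every interior time, as part (a) demands. -/
theorem IsEnergySolution.ae_abs_sub_le_dataDist (hε : 0 < ε) (hT : 0 < T)
    (hg₁ : MemLp g₁ ⊤ volume) (hg₂ : MemLp g₂ ⊤ volume) (hf₁ : MemL1Linf T f₁)
    (hf₂ : MemL1Linf T f₂) (hu₁ : IsEnergySolution ε T H f₁ g₁ u₁ Du₁)
    (hu₂ : IsEnergySolution ε T H f₂ g₂ u₂ Du₂)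
    (hH : ∀ᵐ z ∂(cyl n T), ContDiff ℝ 1 (H z.2 z.1))
    (hb : ∃ M : ℝ, ∀ᵐ z ∂(cyl n T), ‖drift H Du₁ Du₂ z.1 z.2‖ ≤ M)
    {t : ℝ} (ht : t ∈ Ioo 0 T) :
    ∀ᵐ x, |(u₁ t - u₂ t) x| ≤ (dataDist T f₁ f₂ g₁ g₂).toReal := by
  obtain ⟨M, hM⟩ := hb
  have hM' : ∀ᵐ z ∂(cyl n T), ‖drift H Du₁ Du₂ z.1 z.2‖ ≤ max M 0 :=
    hM.mono fun z hz => hz.trans (le_max_left _ _)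
  have hh := abs_hamiltonian_sub_le hH hM'
  have hw := hu₁.isLinearSolution_sub hT hf₁ hf₂ hu₂ hh
  have hfin := dataDist_ne_top hg₁ hg₂ hf₁ hf₂
  obtain ⟨hgf, hff⟩ := ENNReal.add_ne_top.1 hfin
  have hmf : AEMeasurable (fun t => eLpNorm (f₁ t - f₂ t) ⊤ volume)
      (volume.restrict (Ioo 0 T)) :=
    aemeasurable_eLpNorm_top_slice (f := fun t => f₁ t - f₂ t) (hf₁.1.sub hf₂.1)
  set F : ℝ → ℝ := (Ioo 0 T).indicator fun t => (eLpNorm (f₁ t - f₂ t) ⊤ volume).toReal with hF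
  have hFi : Integrable F := by
    rw [hF, integrable_indicator_iff measurableSet_Ioo]
    exact integrable_toReal_of_lintegral_ne_top hmf hff
  have hF0 : ∀ s, 0 ≤ F s := fun s => indicator_nonneg (fun _ _ => ENNReal.toReal_nonneg) s
  set G := (eLpNorm (g₁ - g₂) ⊤ volume).toReal with hG
  have hslice : ∀ᵐ s ∂(volume.restrict (Ioo 0 T)), ∀ᵐ x, |(f₁ s - f₂ s) x| ≤ F s := by
    filter_upwards [ae_lt_top' hmf hff, ae_restrict_mem measurableSet_Ioo] with s h1 h2
    rw [hF, indicator_of_mem h2]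
    exact ae_abs_le_toReal_eLpNorm_top h1.ne
  have hterm : ∀ᵐ x, |(u₁ T - u₂ T) x| ≤ G := by
    filter_upwards [ae_abs_le_toReal_eLpNorm_top hgf, hu₁.terminal, hu₂.terminal] with x h1 h2 h3
    rwa [Pi.sub_apply, h2, h3]
  -- Since `F ≥ 0`, enlarging the interval from `(t, T)` to `(0, T)` gives a bound independent of
  -- `t`.
  have hK : G + ∫ r in t..T, F r ≤ (dataDist T f₁ f₂ g₁ g₂).toReal := by
    unfold dataDist
    rw [ENNReal.toReal_add hgf hff, ← integral_toReal hmf (ae_lt_top' hmf hff),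
      ← integral_indicator measurableSet_Ioo, ← hF, intervalIntegral.integral_of_le ht.2.le]
    gcongr
    exacts [Eventually.of_forall hF0, Measure.restrict_le_self]
  have up := hw.ae_le hε (le_max_right M 0) hh hFi
    (hslice.mono fun s hs => hs.mono fun x hx => (abs_le'.1 hx).1)
    (hterm.mono fun x hx => (abs_le'.1 hx).1) ht
  have down := hw.neg.ae_le hε (le_max_right M 0)
    (hh.mono fun z hz => by
      simp only [Pi.neg_apply, abs_neg, norm_neg] at hz ⊢
      exact hz) hFi
    (hslice.mono fun s hs => hs.mono fun x hx => (abs_le'.1 hx).2)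
    (hterm.mono fun x hx => (abs_le'.1 hx).2) ht
  filter_upwards [up, down] with x h1 h2
  exact abs_le'.2 ⟨h1.trans hK, h2.trans hK⟩

end Estimate

end TorusHJ

end

theorem mainTheorem11 {n : ℕ} (hn : 1 ≤ n) {ε T : ℝ} (hε : 0 < ε) (hT : 0 < T)
    (H : TorusHJ.Torus n → ℝ → TorusHJ.Vec n → ℝ)
    (f₁ f₂ : ℝ → TorusHJ.Torus n → ℝ) (g₁ g₂ : TorusHJ.Torus n → ℝ)
    (u₁ u₂ : ℝ → TorusHJ.Torus n → ℝ) (Du₁ Du₂ : ℝ → TorusHJ.Torus n → TorusHJ.Vec n)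
    (hg₁ : MemLp g₁ ∞ volume) (hg₂ : MemLp g₂ ∞ volume)
    (hf₁ : TorusHJ.MemL1Linf T f₁) (hf₂ : TorusHJ.MemL1Linf T f₂)
    (hu₁ : TorusHJ.IsEnergySolution ε T H f₁ g₁ u₁ Du₁)
    (hu₂ : TorusHJ.IsEnergySolution ε T H f₂ g₂ u₂ Du₂)
    (hH : ∀ᵐ z ∂(TorusHJ.cyl n T), ContDiff ℝ 1 (H z.2 z.1))
    (hb : ∃ M : ℝ, ∀ᵐ z ∂(TorusHJ.cyl n T), ‖TorusHJ.drift H Du₁ Du₂ z.1 z.2‖ ≤ M) :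
    (∀ t ∈ Ioo 0 T, ∀ L : TorusHJ.Torus n → ℝ, TorusHJ.IsWeakLaplacian (u₁ t - u₂ t) L →
      ∃ G : TorusHJ.Torus n → TorusHJ.Vec n, TorusHJ.IsWeakGradient (u₁ t - u₂ t) G ∧
        eLpNorm G 2 volume ^ 2 ≤ eLpNorm L 1 volume * TorusHJ.dataDist T f₁ f₂ g₁ g₂) ∧
    (∀ L : ℝ → TorusHJ.Torus n → ℝ, TorusHJ.IsWeakLaplacianCyl T (fun t => u₁ t - u₂ t) L →
      (∀ᵐ t ∂(volume.restrict (Ioo 0 T)),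
        eLpNorm (Du₁ t - Du₂ t) 2 volume ^ 2
          ≤ eLpNorm (L t) 1 volume * TorusHJ.dataDist T f₁ f₂ g₁ g₂) ∧
      eLpNorm (fun z : ℝ × TorusHJ.Torus n => Du₁ z.1 z.2 - Du₂ z.1 z.2) 2
          (TorusHJ.cyl n T) ^ 2
        ≤ eLpNorm (fun z : ℝ × TorusHJ.Torus n => L z.1 z.2) 1 (TorusHJ.cyl n T)
            * TorusHJ.dataDist T f₁ f₂ g₁ g₂) := by
  have hK := TorusHJ.dataDist_ne_top hg₁ hg₂ hf₁ hf₂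
  have hbound := fun {t : ℝ} (ht : t ∈ Ioo 0 T) =>
    hu₁.ae_abs_sub_le_dataDist hε hT hg₁ hg₂ hf₁ hf₂ hu₂ hH hb ht
  refine ⟨fun t ht L hL => ?_, fun L hL => ?_⟩
  · have h := TorusHJ.exists_isWeakGradient_of_bounded hL.1 hL.2.1 (hbound ht)
      fun m x => hL.conv_laplacian_eq (TorusHJ.isSmooth_mollifier m) x
    rwa [ENNReal.ofReal_toReal hK] at h
  · have hslice : ∀ᵐ t ∂(volume.restrict (Ioo 0 T)), eLpNorm (Du₁ t - Du₂ t) 2 volume ^ 2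
        ≤ eLpNorm (L t) 1 volume * TorusHJ.dataDist T f₁ f₂ g₁ g₂ := by
      have hLs : ∀ᵐ t ∂(volume.restrict (Ioo 0 T)), Integrable (L t) := hL.2.1.prod_right_ae
      filter_upwards [ae_restrict_mem measurableSet_Ioo, hL.ae_conv_laplacian_eq,
        hu₁.isWeakGradient, hu₂.isWeakGradient, hLs] with t ht hlap hD₁ hD₂ hLt
      have hD := hD₁.sub hD₂
      obtain ⟨G, hG, hle⟩ := TorusHJ.exists_isWeakGradient_of_bounded hD.1 hLt (hbound ht) hlap
      -- Uniqueness transfers the bound from the constructed gradient to the given one; finiteness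
      -- of `K` removes the passage through real numbers.
      rwa [eLpNorm_congr_ae (hD.ae_eq hG), ← ENNReal.ofReal_toReal hK]
    refine ⟨hslice, ?_⟩
    have hDm : AEStronglyMeasurable
        (fun z : ℝ × TorusHJ.Torus n => Du₁ z.1 z.2 - Du₂ z.1 z.2) (TorusHJ.cyl n T) :=
      (hu₁.memLp_grad.sub hu₂.memLp_grad).1
    have hLm : AEStronglyMeasurable (fun z : ℝ × TorusHJ.Torus n => L z.1 z.2) (TorusHJ.cyl n T) := hL.2.1.1
    unfold TorusHJ.cyl at hDm hLm ⊢
    rw [TorusHJ.eLpNorm_two_sq, eLpNorm_one_eq_lintegral_enorm, lintegral_prod _ (hDm.enorm.pow_const 2),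
      lintegral_prod _ hLm.enorm, ← lintegral_mul_const' _ _ hK]
    refine lintegral_mono_ae (hslice.mono fun t ht => ?_)
    rwa [TorusHJ.eLpNorm_two_sq, eLpNorm_one_eq_lintegral_enorm] at ht
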